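/- Let $H$ be a (real or complex) Hilbert space and let $(u_i)_{i\in I}$ (for instance $I=\mathbb N$) be a frame for $H$: there are constants $0<A\le B<\infty$ with $A\|x\|^2\le\sum_{i}|\langle x,u_i\rangle|^2\le B\|x\|^2$ for all $x\in H$. Let $T:H\to\ell_2(I)$, $Tx=(\langle x,u_i\rangle)_{i}$, be its analysis operator and $G=TT^*:\ell_2(I)\to\ell_2(I)$ its Gram operator, which is bounded, self-adjoint and positive. For a bounded self-adjoint operator $S$ on a Hilbert space let $S^+$ be its Moore–Penrose pseudo-inverse, i.e. the linear map with domain $\operatorname{ran}(S)\oplus\ker(S)$ given by $S^+=(S|_{\ker(S)^\perp})^{-1}\oplus 0|_{\ker(S)}$. For every $\epsilon>0$ let $g_\epsilon:\mathbb R_+\to\mathbb R_+$, $\mathbb R_+=[0,\infty)$, be piecewise continuous (finitely many discontinuities in each bounded interval, and finite one-sided limits everywhere), and put $g_\epsilon^+(\lambda)=1/g_\epsilon(\lambda)$ if $g_\epsilon(\lambda)\ne0$ and $g_\epsilon^+(\lambda)=0$ otherwise. Assume: 1. $g_\epsilon(\lambda)\in\{0\}\cup[\epsilon,\infty)$ for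 all $\epsilon>0$ and $\lambda\ge0$; 2. $\lim_{\epsilon\to0^+}\lambda g_\epsilon^+(\lambda)=1$ for every $\lambda>0$; 3. there is a constant $C$ with $\lambda g_\epsilon^+(\lambda)\le C$ for all $\epsilon>0$ and $\lambda\ge0$. Then for every $\epsilon>0$ the bounded self-adjoint operator $G_\epsilon=g_\epsilon(G)$ is well defined by the Borel functional calculus of $G$, the pseudo-inverses $G^+$ and $G_\epsilon^+$ are everywhere defined bounded operators on $\ell_2(I)$, and * $\|G_\epsilon^+\|\le 1/\epsilon$ for every $\epsilon>0$; * $\|G_\epsilon^+Tx-G^+Tx\|\to0$ as $\epsilon\to0^+$, for every $x\in H$. Moreover, the assumptions on $(g_\epsilon)_{\epsilon>0}$ are satisfied by Tikhonov regularisation, $g_\epsilon(\lambda)=\lambda+\epsilon$, and by spectral cutoff, $g_\epsilon(\lambda)=\lambda$ for $\lambda>\epsilon$ and $g_\epsilon(\lambda)=0$ for $\lambda\le\epsilon$. -/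

import Mathlib

open Filter MeasureTheory
open scoped NNReal Topology

noncomputable section

/-! ### Frames, the analysis operator and the Gram operator -/

section Frames

variable {𝕜 : Type*} [RCLike 𝕜] {ι : Type*}
  {H : Type*} [NormedAddCommGroup H] [InnerProductSpace 𝕜 H]

/-- The Hilbert space of square-summable scalar families indexed by `ι`. -/
abbrev EllTwo (𝕜 : Type*) [RCLike 𝕜] (ι : Type*) : Type _ := lp (fun _ : ι => 𝕜) 2

/-- A Bessel family: for some `B > 0`, `∑ i, |⟨x, u i⟩|² ≤ B ‖x‖²` for all `x`. -/
def IsBessel (𝕜 : Type*) [RCLike 𝕜] {ι H : Type*} [NormedAddCommGroup H]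
    [InnerProductSpace 𝕜 H] (u : ι → H) : Prop :=
  ∃ B : ℝ, 0 < B ∧ ∀ x : H, Summable (fun i => ‖inner 𝕜 (u i) x‖ ^ 2) ∧
    ∑' i, ‖inner 𝕜 (u i) x‖ ^ 2 ≤ B * ‖x‖ ^ 2

/-- A frame: for some `0 < A ≤ B`, `A ‖x‖² ≤ ∑ i, |⟨x, u i⟩|² ≤ B ‖x‖²` for all `x`. -/
def IsFrame (𝕜 : Type*) [RCLike 𝕜] {ι H : Type*} [NormedAddCommGroup H]
    [InnerProductSpace 𝕜 H] (u : ι → H) : Prop :=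
  ∃ A B : ℝ, 0 < A ∧ A ≤ B ∧ ∀ x : H, Summable (fun i => ‖inner 𝕜 (u i) x‖ ^ 2) ∧
    A * ‖x‖ ^ 2 ≤ ∑' i, ‖inner 𝕜 (u i) x‖ ^ 2 ∧
    ∑' i, ‖inner 𝕜 (u i) x‖ ^ 2 ≤ B * ‖x‖ ^ 2

theorem IsFrame.isBessel {u : ι → H} (hu : IsFrame 𝕜 u) : IsBessel 𝕜 u := by
  obtain ⟨A, B, hA, hAB, h⟩ := hu
  exact ⟨B, hA.trans_le hAB, fun x => ⟨(h x).1, (h x).2.2⟩⟩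

theorem IsBessel.memlp {u : ι → H} (hu : IsBessel 𝕜 u) (x : H) :
    Memℓp (fun i => inner 𝕜 (u i) x) 2 := by
  obtain ⟨B, -, h⟩ := hu
  apply memℓp_gen
  simpa using (h x).1

/-- The analysis operator `T : H → ℓ²`, `x ↦ (⟨x, u i⟩)ᵢ` (Mathlib's inner product is linear in
its second argument). -/
def analysisOp (u : ι → H) (hu : IsBessel 𝕜 u) : H →L[𝕜] EllTwo 𝕜 ι :=
  LinearMap.mkContinuousOfExistsBound
    { toFun := fun x => (⟨fun i => inner 𝕜 (u i) x, hu.memlp x⟩ : EllTwo 𝕜 ι)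
      map_add' := fun x y => by ext i; exact inner_add_right _ _ _
      map_smul' := fun c x => by ext i; exact inner_smul_right _ _ _ }
    (by
      obtain ⟨B, hB, h⟩ := id hu
      refine ⟨√B, fun x => ?_⟩
      refine abs_le_of_sq_le_sq' ?_ (by positivity) |>.2
      rw [mul_pow, Real.sq_sqrt hB.le]
      refine le_trans (le_of_eq ?_) (h x).2
      have h2 := lp.norm_rpow_eq_tsum (p := 2) (by norm_num)
        (⟨fun i => inner 𝕜 (u i) x, hu.memlp x⟩ : EllTwo 𝕜 ι)
      simpa using h2)

/-- The Gram operator `G = T T*` on `ℓ²`; the adjoint `T*` is the synthesis operator. -/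
def gramOp [CompleteSpace H] (u : ι → H) (hu : IsBessel 𝕜 u) : EllTwo 𝕜 ι →L[𝕜] EllTwo 𝕜 ι :=
  (analysisOp u hu) ∘L (ContinuousLinearMap.adjoint (analysisOp u hu))

theorem gramOp_isSelfAdjoint [CompleteSpace H] (u : ι → H) (hu : IsBessel 𝕜 u) :
    IsSelfAdjoint (gramOp u hu) := by
  rw [ContinuousLinearMap.isSelfAdjoint_iff']
  simp [gramOp, ContinuousLinearMap.adjoint_comp]

end Frames

/-! ### The Moore–Penrose pseudo-inverse of a bounded self-adjoint operator -/

section MoorePenrose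

variable {𝕜 : Type*} [RCLike 𝕜] {E : Type*} [NormedAddCommGroup E] [InnerProductSpace 𝕜 E]

/-- The restriction of `S` to the orthogonal complement of its kernel. -/
def restrictKerPerp (S : E →L[𝕜] E) : E →ₗ.[𝕜] E :=
  (S : E →ₗ[𝕜] E).toPMap (LinearMap.ker (S : E →ₗ[𝕜] E))ᗮ

theorem restrictKerPerp_ker (S : E →L[𝕜] E) :
    LinearMap.ker (restrictKerPerp S).toFun = ⊥ := by
  rw [LinearMap.ker_eq_bot']
  intro m hm
  have h1 : (m : E) ∈ LinearMap.ker (S : E →ₗ[𝕜] E) := hm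
  have h2 : (m : E) ∈ (LinearMap.ker (S : E →ₗ[𝕜] E))ᗮ := m.2
  exact Subtype.ext (inner_self_eq_zero.1 (h2 m h1))

theorem moorePenrose_agree [CompleteSpace E] (S : E →L[𝕜] E) (hS : IsSelfAdjoint S)
    (y : (restrictKerPerp S).inverse.domain)
    (k : ((0 : E →ₗ[𝕜] E).toPMap (LinearMap.ker (S : E →ₗ[𝕜] E))).domain)
    (h : (y : E) = k) :
    (restrictKerPerp S).inverse y =
      (0 : E →ₗ[𝕜] E).toPMap (LinearMap.ker (S : E →ₗ[𝕜] E)) k := by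
  have hy : (y : E) ∈ LinearMap.range (restrictKerPerp S).toFun := by
    rw [← LinearPMap.inverse_domain]; exact y.2
  obtain ⟨w, hw⟩ := hy
  have hw' : S (w : E) = (y : E) := hw
  have hk : S (k : E) = 0 := k.2
  have h0 : (y : E) = 0 := by
    have : inner 𝕜 (y : E) (y : E) = 0 := by
      conv_lhs => rw [← hw']
      have h3 := (ContinuousLinearMap.isSelfAdjoint_iff_isSymmetric.1 hS) (w : E) (S w)
      have h4 : S (S (w : E)) = 0 := by rw [hw', h, hk]
      have h5 : inner 𝕜 (S (w : E)) (S (w : E)) = inner 𝕜 (w : E) (S (S (w : E))) := h3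
      rw [h5, h4, inner_zero_right]
    exact inner_self_eq_zero.1 this
  have : y = 0 := Subtype.ext h0
  rw [this, LinearPMap.map_zero]
  rfl

/-- The Moore–Penrose pseudo-inverse of a bounded self-adjoint operator `S`, as a partially
defined linear map with domain `ran S ⊕ ker S`: it is `(S|_{(ker S)ᗮ})⁻¹` on
`ran S = S ((ker S)ᗮ)` and `0` on `ker S`. -/
def moorePenrose [CompleteSpace E] (S : E →L[𝕜] E) (hS : IsSelfAdjoint S) : E →ₗ.[𝕜] E :=
  (restrictKerPerp S).inverse.sup ((0 : E →ₗ[𝕜] E).toPMap (LinearMap.ker (S : E →ₗ[𝕜] E)))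
    (moorePenrose_agree S hS)

end MoorePenrose

/-! ### The Borel functional calculus of a bounded self-adjoint operator -/

section FunctionalCalculus

variable {𝕜 : Type*} [RCLike 𝕜] {E : Type*} [NormedAddCommGroup E] [InnerProductSpace 𝕜 E]
  [CompleteSpace E]

/-- `μ` is the spectral measure of the self-adjoint operator `S` at the vector `a`: the finite
Borel measure carried by the spectrum of `S` with `∫ p dμ = ⟨a, p(S) a⟩` for every polynomial `p`
(equivalently, for every monomial). -/
structure IsSpectralMeasureAt (S : E →L[𝕜] E) (a : E) (μ : Measure ℝ) : Prop where
  finite : IsFiniteMeasure μ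
  supported : μ {t : ℝ | ((t : ℝ) : 𝕜) ∉ spectrum 𝕜 S} = 0
  moments : ∀ n : ℕ, ((∫ t, t ^ n ∂μ : ℝ) : 𝕜) = inner 𝕜 a ((S ^ n) a)

/-- `F = f(S)` in the Borel functional calculus of the self-adjoint operator `S`, for a real
function `f`: `F` is the bounded self-adjoint operator with `⟨a, F a⟩ = ∫ f dμ_a` for every
vector `a`, where `μ_a` is the spectral measure of `S` at `a`. -/
def IsBorelCalculus (S : E →L[𝕜] E) (f : ℝ → ℝ) (F : E →L[𝕜] E) : Prop :=
  IsSelfAdjoint F ∧ ∀ a : E, ∃ μ : Measure ℝ, IsSpectralMeasureAt S a μ ∧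
    Integrable f μ ∧ inner 𝕜 a (F a) = ((∫ t, f t ∂μ : ℝ) : 𝕜)

open Classical in
/-- The operator `f(S)` (with the value `0` if there is none). -/
def borelCalculus (S : E →L[𝕜] E) (f : ℝ → ℝ) : E →L[𝕜] E :=
  if h : ∃ F, IsBorelCalculus S f F then h.choose else 0

theorem borelCalculus_isSelfAdjoint (S : E →L[𝕜] E) (f : ℝ → ℝ) :
    IsSelfAdjoint (borelCalculus S f) := by
  unfold borelCalculus
  split_ifs with h
  · exact h.choose_spec.1
  · exact IsSelfAdjoint.zero _

end FunctionalCalculus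

/-! ### Spectral regularisations -/

/-- Piecewise continuity on `ℝ₊`: finitely many discontinuities in every bounded interval, and
finite one-sided limits at every point. (At `0` the left filter is trivial.) -/
def PiecewiseContinuous (f : ℝ≥0 → ℝ≥0) : Prop :=
  (∀ R : ℝ≥0, {x : ℝ≥0 | x ≤ R ∧ ¬ ContinuousAt f x}.Finite) ∧
  ∀ x : ℝ≥0, (∃ l : ℝ≥0, Tendsto f (𝓝[<] x) (𝓝 l)) ∧ (∃ l : ℝ≥0, Tendsto f (𝓝[>] x) (𝓝 l))

/-- The pseudo-inverse function `f⁺`: `1 / f` where `f ≠ 0`, and `0` elsewhere. -/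
def pinvFun (f : ℝ≥0 → ℝ≥0) (t : ℝ≥0) : ℝ≥0 := if f t ≠ 0 then 1 / f t else 0

/-- A family of spectral maps `g ε : ℝ₊ → ℝ₊`, of which only the members with `ε > 0` matter. -/
structure IsSpectralRegularisation (g : ℝ → ℝ≥0 → ℝ≥0) : Prop where
  piecewiseContinuous : ∀ ε : ℝ, 0 < ε → PiecewiseContinuous (g ε)
  gap : ∀ ε : ℝ, 0 < ε → ∀ t : ℝ≥0, g ε t = 0 ∨ ε ≤ (g ε t : ℝ)
  tendsto_one : ∀ t : ℝ≥0, 0 < t → Tendsto (fun ε : ℝ => t * pinvFun (g ε) t) (𝓝[>] 0) (𝓝 1)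
  bounded : ∃ C : ℝ≥0, ∀ ε : ℝ, 0 < ε → ∀ t : ℝ≥0, t * pinvFun (g ε) t ≤ C

/-- Tikhonov regularisation, `t ↦ t + ε`. -/
def tikhonov (ε : ℝ) (t : ℝ≥0) : ℝ≥0 := t + ε.toNNReal

/-- Spectral cutoff, `t ↦ t` for `t > ε` and `0` otherwise. -/
def spectralCutoff (ε : ℝ) (t : ℝ≥0) : ℝ≥0 := if ε < (t : ℝ) then t else 0

/-- A function on `ℝ₊` as a real function; the values at negative reals are irrelevant for the
functional calculus of a positive operator. -/
def extendReal (f : ℝ≥0 → ℝ≥0) (t : ℝ) : ℝ := (f t.toNNReal : ℝ)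

/-- The regularised operator `g(S)`. -/
def regularisedOp {𝕜 : Type*} [RCLike 𝕜] {E : Type*} [NormedAddCommGroup E]
    [InnerProductSpace 𝕜 E] [CompleteSpace E] (g : ℝ≥0 → ℝ≥0) (S : E →L[𝕜] E) : E →L[𝕜] E :=
  borelCalculus S (extendReal g)

theorem regularisedOp_isSelfAdjoint {𝕜 : Type*} [RCLike 𝕜] {E : Type*} [NormedAddCommGroup E]
    [InnerProductSpace 𝕜 E] [CompleteSpace E] (g : ℝ≥0 → ℝ≥0) (S : E →L[𝕜] E) :
    IsSelfAdjoint (regularisedOp g S) :=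
  borelCalculus_isSelfAdjoint S _

end

/-!
The Borel functional calculus of a bounded self-adjoint operator `S` on a real or complex Hilbert
space is built from polynomials, uniformly in the scalar field.

*Spectral measures.* Compressing `S` to the span of `a, S a, …, Sⁿ a` and diagonalising gives a
discrete measure on `[-‖S‖, ‖S‖]` whose moments up to order `n` are `⟨a, Sʲ a⟩`. A weak limit point
has all the moments right (`exists_measure_moments`). It does not charge the resolvent set, because
`‖p(S) a‖` is the `L²` norm of `p` and `r - S` is bounded below when `r` is in the resolvent set
(`measure_ball_eq_zero_of_moments`). Uniqueness is Weierstrass' theorem.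

*Calculus.* Since `p ↦ p(S) a` is isometric for `L²(μ_a)`, where polynomials are dense, every
locally bounded Borel function `f` has a value `f(S) a`. It is characterised by
`‖f(S) a - p(S) a‖ = ‖f - p‖` in `L²(μ_a)` for all polynomials `p` (`IsCalculusVector`).
Approximating in `L²` of a sum of several spectral measures transfers linearity, symmetry and
multiplicativity from polynomials to `f(S)` (`exists_isCalculusOp`, `IsCalculusOp.mul`). Unlike an
argument by polarisation, this treats real and complex scalars alike.

*Regularisation.* Multiplicativity shows that `g(S)` and `g⁺(S)` satisfy the Penrose equations and
commute, so that `g⁺(S)` is the pseudo-inverse of `g(S)`; it is bounded by `sup g⁺ ≤ 1 / ε`. For a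
frame, `T* T` is invertible, and `P = T (T* T)⁻² T*` is the pseudo-inverse of `G = T T*`. As
`T x = G y` with `y = P T x` orthogonal to `ker G`, the error `g_ε⁺(G) T x - P T x` is
`(g_ε⁺(G) G - 1) y`, whose squared norm is `∫ (λ g_ε⁺(λ) - 1)² dμ_y`. The measure `μ_y` lives on
`(0, ∞)` (`IsSpectralMeasureAt.ae_pos`), so dominated convergence applies.
-/

/-! ### Locally bounded Borel functions and polynomial approximation -/

section Approximation

/-- A real function that is Borel measurable and bounded on every bounded interval. The Borel
functional calculus is developed for this class: it contains all polynomials and is closed under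
sums and products. -/
structure IsLocallyBoundedBorel (f : ℝ → ℝ) : Prop where
  measurable : Measurable f
  bounded : ∀ R : ℝ, ∃ C : ℝ≥0, ∀ t, |t| ≤ R → |f t| ≤ C

theorem IsLocallyBoundedBorel.of_continuous {f : ℝ → ℝ} (hf : Continuous f) :
    IsLocallyBoundedBorel f := by
  refine ⟨hf.measurable, fun R => ?_⟩
  obtain ⟨C, hC⟩ := (isCompact_Icc (a := -R) (b := R)).exists_bound_of_continuousOn hf.continuousOn
  exact ⟨C.toNNReal, fun t ht => (hC t (abs_le.1 ht)).trans (Real.le_coe_toNNReal C)⟩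

theorem IsLocallyBoundedBorel.polynomial (p : Polynomial ℝ) :
    IsLocallyBoundedBorel (fun t => p.eval t) :=
  .of_continuous p.continuous

theorem IsLocallyBoundedBorel.mul {f g : ℝ → ℝ} (hf : IsLocallyBoundedBorel f)
    (hg : IsLocallyBoundedBorel g) : IsLocallyBoundedBorel (fun t => f t * g t) := by
  refine ⟨hf.measurable.mul hg.measurable, fun R => ?_⟩
  obtain ⟨C, hC⟩ := hf.bounded R
  obtain ⟨D, hD⟩ := hg.bounded R
  refine ⟨C * D, fun t ht => ?_⟩
  rw [abs_mul, NNReal.coe_mul]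
  exact mul_le_mul (hC t ht) (hD t ht) (abs_nonneg _) C.2

theorem IsLocallyBoundedBorel.memLp {f : ℝ → ℝ} (hf : IsLocallyBoundedBorel f) {μ : Measure ℝ}
    [IsFiniteMeasure μ] {R : ℝ} (hR : ∀ᵐ t ∂μ, |t| ≤ R) (q : ENNReal) : MemLp f q μ := by
  obtain ⟨C, hC⟩ := hf.bounded R
  exact MemLp.of_bound hf.measurable.aestronglyMeasurable C (hR.mono fun t ht => hC t ht)

theorem IsLocallyBoundedBorel.integrable {f : ℝ → ℝ} (hf : IsLocallyBoundedBorel f)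
    {μ : Measure ℝ} [IsFiniteMeasure μ] {R : ℝ} (hR : ∀ᵐ t ∂μ, |t| ≤ R) : Integrable f μ :=
  memLp_one_iff_integrable.1 (hf.memLp hR 1)

theorem IsLocallyBoundedBorel.exists_eLpNorm_mul_le {f : ℝ → ℝ} (hf : IsLocallyBoundedBorel f)
    {μ : Measure ℝ} {R : ℝ} (hR : ∀ᵐ t ∂μ, |t| ≤ R) :
    ∃ C : ℝ≥0, ∀ g : ℝ → ℝ, eLpNorm (fun t => f t * g t) 2 μ ≤ C * eLpNorm g 2 μ := by
  obtain ⟨C, hC⟩ := hf.bounded R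
  refine ⟨C, fun g => eLpNorm_le_nnreal_smul_eLpNorm_of_ae_le_mul (hR.mono fun t ht => ?_) 2⟩
  rw [nnnorm_mul]
  gcongr
  exact hC t ht

/-- Weierstrass' theorem in `L²` of a finite measure carried by `[-R, R]`. -/
theorem exists_polynomial_eLpNorm_sub_le {f : ℝ → ℝ} {μ : Measure ℝ} [IsFiniteMeasure μ] {R : ℝ}
    (hR : ∀ᵐ t ∂μ, |t| ≤ R) (hf : MemLp f 2 μ) {ε : ENNReal} (hε : ε ≠ 0) :
    ∃ p : Polynomial ℝ, eLpNorm (fun t => f t - p.eval t) 2 μ ≤ ε := by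
  have hε2 : ε / 2 ≠ 0 := by simpa using hε
  obtain ⟨h, hfh, hh⟩ := hf.exists_boundedContinuous_eLpNorm_sub_le (by norm_num) hε2
  set m : ENNReal := μ Set.univ ^ (2 : ENNReal).toReal⁻¹ with hm
  have hmtop : m ≠ ⊤ := ENNReal.rpow_ne_top_of_nonneg (by positivity) (measure_ne_top _ _)
  obtain ⟨δ, hδ, hδm⟩ : ∃ δ : ℝ, 0 < δ ∧ m * ENNReal.ofReal δ ≤ ε / 2 := by
    have h0 : Tendsto (fun δ : ℝ => m * ENNReal.ofReal δ) (𝓝[>] 0) (𝓝 0) := by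
      have : Tendsto (fun δ : ℝ => m * ENNReal.ofReal δ) (𝓝[>] 0) (𝓝 (m * ENNReal.ofReal 0)) :=
        ENNReal.Tendsto.const_mul
          ((ENNReal.continuous_ofReal.tendsto 0).mono_left nhdsWithin_le_nhds) (Or.inr hmtop)
      simpa using this
    have h1 := h0.eventually (gt_mem_nhds (pos_iff_ne_zero.2 hε2))
    obtain ⟨δ, h2, h3⟩ := (h1.and self_mem_nhdsWithin).exists
    exact ⟨δ, h3, h2.le⟩
  obtain ⟨p, hp⟩ := exists_polynomial_near_of_continuousOn (-R) R h h.continuous.continuousOn δ hδ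
  refine ⟨p, ?_⟩
  have h4 : eLpNorm (fun t => h t - p.eval t) 2 μ ≤ m * ENNReal.ofReal δ := by
    refine eLpNorm_le_of_ae_bound (hR.mono fun t ht => ?_)
    rw [Real.norm_eq_abs, abs_sub_comm]
    exact (hp t (abs_le.1 ht)).le
  have h5 : (fun t => f t - p.eval t) = (f - h) + fun t => h t - p.eval t := by
    ext t; simp
  rw [h5]
  refine (eLpNorm_add_le (hf.1.sub hh.1)
    (hh.1.sub (p.continuous.aestronglyMeasurable)) (by norm_num)).trans ?_
  calc _ ≤ ε / 2 + ε / 2 := add_le_add hfh (h4.trans hδm)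
    _ = ε := ENNReal.add_halves ε

theorem exists_seq_polynomial_tendsto {f : ℝ → ℝ} {μ : Measure ℝ} [IsFiniteMeasure μ] {R : ℝ}
    (hR : ∀ᵐ t ∂μ, |t| ≤ R) (hf : MemLp f 2 μ) :
    ∃ p : ℕ → Polynomial ℝ,
      Tendsto (fun n => eLpNorm (fun t => f t - (p n).eval t) 2 μ) atTop (𝓝 0) := by
  have h : ∀ n : ℕ, ((n : ENNReal) + 1)⁻¹ ≠ 0 := fun n => by simp
  choose p hp using fun n => exists_polynomial_eLpNorm_sub_le hR hf (h n)
  refine ⟨p, tendsto_of_tendsto_of_tendsto_of_le_of_le tendsto_const_nhds ?_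
    (fun _ => zero_le) hp⟩
  have := (tendsto_add_atTop_iff_nat 1).2 ENNReal.tendsto_inv_nat_nhds_zero
  simpa using this

/-- The triangle inequality for `L²` distances of measurable functions. -/
theorem eLpNorm_sub_le_add {f g h : ℝ → ℝ} {μ : Measure ℝ} (hf : Measurable f)
    (hg : Measurable g) (hh : Measurable h) :
    eLpNorm (fun t => f t - h t) 2 μ ≤
      eLpNorm (fun t => f t - g t) 2 μ + eLpNorm (fun t => g t - h t) 2 μ := by
  have h5 : (fun t => f t - h t) = (fun t => f t - g t) + fun t => g t - h t := by
    ext t; simp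
  rw [h5]
  exact eLpNorm_add_le (hf.sub hg).aestronglyMeasurable (hg.sub hh).aestronglyMeasurable
    (by norm_num)

theorem eLpNorm_sub_rev (f g : ℝ → ℝ) (μ : Measure ℝ) :
    eLpNorm (fun t => f t - g t) 2 μ = eLpNorm (fun t => g t - f t) 2 μ := by
  rw [← eLpNorm_neg]
  congr 1
  ext t; simp

theorem ofReal_integral_sq {f : ℝ → ℝ} {μ : Measure ℝ} (hf : MemLp f 2 μ) :
    ENNReal.ofReal (∫ t, f t ^ 2 ∂μ) = eLpNorm f 2 μ ^ 2 := by
  have hi : 0 ≤ ∫ t, f t ^ 2 ∂μ := integral_nonneg fun t => sq_nonneg _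
  rw [hf.eLpNorm_eq_integral_rpow_norm (by norm_num) (by norm_num),
    ← ENNReal.ofReal_pow (by positivity)]
  congr 1
  have : (∫ t, ‖f t‖ ^ (2 : ENNReal).toReal ∂μ) = ∫ t, f t ^ 2 ∂μ := by
    congr 1; ext t; simp
  rw [this]
  simp only [ENNReal.toReal_ofNat]
  rw [← Real.rpow_natCast, ← Real.rpow_mul hi]
  norm_num

/-- `L²` convergence on a finite measure implies convergence of the integrals. -/
theorem tendsto_integral_of_tendsto_eLpNorm_two {f : ℝ → ℝ} {p : ℕ → ℝ → ℝ} {μ : Measure ℝ}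
    [IsFiniteMeasure μ] {R : ℝ} (hR : ∀ᵐ t ∂μ, |t| ≤ R) (hf : IsLocallyBoundedBorel f)
    (hp : ∀ n, IsLocallyBoundedBorel (p n))
    (h : Tendsto (fun n => eLpNorm (fun t => f t - p n t) 2 μ) atTop (𝓝 0)) :
    Tendsto (fun n => ∫ t, p n t ∂μ) atTop (𝓝 (∫ t, f t ∂μ)) := by
  refine tendsto_integral_of_L1' f hf.measurable.aestronglyMeasurable
    (.of_forall fun n => (hp n).integrable hR) ?_
  have hb : ∀ n, eLpNorm (p n - f) 1 μ ≤ eLpNorm (fun t => f t - p n t) 2 μ *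
      μ Set.univ ^ (1 / (1 : ENNReal).toReal - 1 / (2 : ENNReal).toReal) := by
    intro n
    rw [eLpNorm_sub_rev f]
    exact eLpNorm_le_eLpNorm_mul_rpow_measure_univ (by norm_num : (1 : ENNReal) ≤ 2)
      ((hp n).measurable.sub hf.measurable).aestronglyMeasurable
  refine tendsto_of_tendsto_of_tendsto_of_le_of_le tendsto_const_nhds ?_
    (fun _ => zero_le) hb
  have := ENNReal.Tendsto.mul_const h (b := μ Set.univ ^
    (1 / (1 : ENNReal).toReal - 1 / (2 : ENNReal).toReal))
    (Or.inr (ENNReal.rpow_ne_top_of_nonneg (by norm_num) (measure_ne_top _ _)))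
  simpa using this

/-- A finite measure on a bounded interval is determined by its moments. -/
theorem measure_eq_of_integral_polynomial_eq {μ ν : Measure ℝ} [IsFiniteMeasure μ] [IsFiniteMeasure ν]
    {R : ℝ} (hμ : ∀ᵐ t ∂μ, |t| ≤ R) (hν : ∀ᵐ t ∂ν, |t| ≤ R)
    (h : ∀ p : Polynomial ℝ, ∫ t, p.eval t ∂μ = ∫ t, p.eval t ∂ν) : μ = ν := by
  refine ext_of_forall_integral_eq_of_IsFiniteMeasure fun f => ?_
  have hf : IsLocallyBoundedBorel f := .of_continuous f.continuous
  have hμν : ∀ᵐ t ∂(μ + ν), |t| ≤ R := by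
    rw [ae_add_measure_iff]; exact ⟨hμ, hν⟩
  obtain ⟨p, hp⟩ := exists_seq_polynomial_tendsto hμν (hf.memLp hμν 2)
  have key : ∀ ρ : Measure ℝ, IsFiniteMeasure ρ → ρ ≤ μ + ν → (∀ᵐ t ∂ρ, |t| ≤ R) →
      Tendsto (fun n => ∫ t, (p n).eval t ∂ρ) atTop (𝓝 (∫ t, f t ∂ρ)) := by
    intro ρ hρ hle hR
    exact tendsto_integral_of_tendsto_eLpNorm_two hR hf (fun n => .polynomial (p n))
      (tendsto_of_tendsto_of_tendsto_of_le_of_le tendsto_const_nhds hp (fun _ => zero_le)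
        fun n => eLpNorm_mono_measure _ hle)
  have h1 := key μ inferInstance (Measure.le_add_right le_rfl) hμ
  have h2 := key ν inferInstance (Measure.le_add_left le_rfl) hν
  simp_rw [h] at h1
  exact tendsto_nhds_unique h1 h2

end Approximation

/-! ### Real polynomials in a self-adjoint operator -/

section PolynomialCalculus

variable {𝕜 : Type*} [RCLike 𝕜] {E : Type*} [NormedAddCommGroup E] [InnerProductSpace 𝕜 E]

/-- The operator `p(S)` for a polynomial `p` with real coefficients, as a ring homomorphism in
`p`. -/
noncomputable def polyOp (S : E →L[𝕜] E) : Polynomial ℝ →+* (E →L[𝕜] E) :=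
  (Polynomial.aeval S : Polynomial 𝕜 →ₐ[𝕜] (E →L[𝕜] E)).toRingHom.comp
    (Polynomial.mapRingHom (algebraMap ℝ 𝕜))

theorem polyOp_apply (S : E →L[𝕜] E) (p : Polynomial ℝ) :
    polyOp S p = Polynomial.aeval S (p.map (algebraMap ℝ 𝕜)) := rfl

@[simp] theorem polyOp_X (S : E →L[𝕜] E) : polyOp S Polynomial.X = S := by
  simp [polyOp_apply]

@[simp] theorem polyOp_C (S : E →L[𝕜] E) (c : ℝ) :
    polyOp S (Polynomial.C c) = (c : 𝕜) • (1 : E →L[𝕜] E) := by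
  simp [polyOp_apply, Algebra.algebraMap_eq_smul_one]

theorem polyOp_monomial (S : E →L[𝕜] E) (n : ℕ) (c : ℝ) :
    polyOp S (Polynomial.monomial n c) = (c : 𝕜) • S ^ n := by
  rw [polyOp_apply, Polynomial.map_monomial, Polynomial.aeval_monomial,
    Algebra.algebraMap_eq_smul_one, smul_mul_assoc, one_mul]

theorem polyOp_isSelfAdjoint [CompleteSpace E] {S : E →L[𝕜] E} (hS : IsSelfAdjoint S)
    (p : Polynomial ℝ) : IsSelfAdjoint (polyOp S p) := by
  induction p using Polynomial.induction_on' with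
  | add p q hp hq => rw [map_add]; exact hp.add hq
  | monomial n c =>
    rw [polyOp_monomial]
    refine IsSelfAdjoint.smul ?_ (hS.pow n)
    simp [IsSelfAdjoint]

theorem inner_polyOp_left [CompleteSpace E] {S : E →L[𝕜] E} (hS : IsSelfAdjoint S)
    (p : Polynomial ℝ) (a b : E) : inner 𝕜 (polyOp S p a) b = inner 𝕜 a (polyOp S p b) :=
  ContinuousLinearMap.isSelfAdjoint_iff_isSymmetric.1 (polyOp_isSelfAdjoint hS p) a b

/-- The moment identities extend from monomials to polynomials. -/
theorem integral_polynomial_of_moments {S : E →L[𝕜] E} {a : E} {μ : Measure ℝ}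
    [IsFiniteMeasure μ] {R : ℝ} (hR : ∀ᵐ t ∂μ, |t| ≤ R)
    (hm : ∀ n : ℕ, ((∫ t, t ^ n ∂μ : ℝ) : 𝕜) = inner 𝕜 a ((S ^ n) a)) (p : Polynomial ℝ) :
    ((∫ t, p.eval t ∂μ : ℝ) : 𝕜) = inner 𝕜 a (polyOp S p a) := by
  induction p using Polynomial.induction_on' with
  | add p q hp hq =>
    simp only [Polynomial.eval_add, map_add, add_apply, inner_add_right]
    rw [integral_add ((IsLocallyBoundedBorel.polynomial p).integrable hR)
      ((IsLocallyBoundedBorel.polynomial q).integrable hR), RCLike.ofReal_add, hp, hq]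
  | monomial n c =>
    simp only [Polynomial.eval_monomial, polyOp_monomial, integral_const_mul, RCLike.ofReal_mul,
      hm n, smul_apply, inner_smul_right]

/-- `p ↦ p(S) a` is isometric for the norm of `L²(μ)`. -/
theorem enorm_polyOp_of_moments [CompleteSpace E] {S : E →L[𝕜] E} (hS : IsSelfAdjoint S) {a : E}
    {μ : Measure ℝ} [IsFiniteMeasure μ] {R : ℝ} (hR : ∀ᵐ t ∂μ, |t| ≤ R)
    (hm : ∀ n : ℕ, ((∫ t, t ^ n ∂μ : ℝ) : 𝕜) = inner 𝕜 a ((S ^ n) a)) (p : Polynomial ℝ) :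
    ‖polyOp S p a‖ₑ = eLpNorm (fun t => p.eval t) 2 μ := by
  have h1 : ‖polyOp S p a‖ ^ 2 = ∫ t, p.eval t ^ 2 ∂μ := by
    have h2 := integral_polynomial_of_moments hR hm (p * p)
    rw [map_mul, mul_apply_eq_comp, ← inner_polyOp_left hS, inner_self_eq_norm_sq_to_K,
      ← RCLike.ofReal_pow, RCLike.ofReal_inj] at h2
    rw [← h2]
    congr 1; ext t
    rw [Polynomial.eval_mul, sq]
  have h3 := ofReal_integral_sq ((IsLocallyBoundedBorel.polynomial p).memLp hR 2)
  rw [← h1, ENNReal.ofReal_pow (norm_nonneg _), ofReal_norm] at h3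
  exact (ENNReal.rpow_left_injective (x := 2) two_ne_zero) (by simpa using h3)

end PolynomialCalculus

/-! ### Existence and uniqueness of spectral measures -/

section SpectralMeasure

variable {𝕜 : Type*} [RCLike 𝕜] {E : Type*} [NormedAddCommGroup E] [InnerProductSpace 𝕜 E]

/-- The compression of a symmetric operator to a finite-dimensional subspace, diagonalised,
gives for each `n` a measure on `[-‖S‖, ‖S‖]` with finitely many atoms whose moments up to order
`n` are those of `S` at `a`. -/
theorem exists_finiteMeasure_truncated_moments (S : E →L[𝕜] E)
    (hS : (S : E →ₗ[𝕜] E).IsSymmetric) (a : E) (n : ℕ) :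
    ∃ μ : FiniteMeasure (Set.Icc (-‖S‖) ‖S‖), μ.mass ≤ ‖a‖₊ ^ 2 ∧
      ∀ j ≤ n, ((∫ t, (t : ℝ) ^ j ∂(μ : Measure (Set.Icc (-‖S‖) ‖S‖)) : ℝ) : 𝕜) =
        inner 𝕜 a ((S ^ j) a) := by
  let K : Submodule 𝕜 E := Submodule.span 𝕜 (Set.range fun j : Fin (n + 1) => (S ^ (j : ℕ)) a)
  have : FiniteDimensional 𝕜 K := FiniteDimensional.span_of_finite 𝕜 (Set.finite_range _)
  have hmem : ∀ j ≤ n, (S ^ j) a ∈ K := fun j hj =>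
    Submodule.subset_span ⟨⟨j, Nat.lt_succ_of_le hj⟩, rfl⟩
  -- the compression of `S` to `K`; its powers agree with those of `S` at `a` up to order `n`
  let A : K →L[𝕜] K := K.orthogonalProjectionOnto ∘L S ∘L K.subtypeL
  have hA : (A : K →ₗ[𝕜] K).IsSymmetric := by
    intro x y
    have h1 : inner 𝕜 (A x) y = inner 𝕜 (S x) (y : E) :=
      K.inner_orthogonalProjectionOnto_eq_of_mem_right y (S x)
    have h2 : inner 𝕜 x (A y) = inner 𝕜 (x : E) (S y) :=
      K.inner_orthogonalProjectionOnto_eq_of_mem_left x (S y)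
    exact h1.trans ((hS x y).trans h2.symm)
  let a' : K := ⟨a, by simpa using hmem 0 (Nat.zero_le _)⟩
  have hpow : ∀ j ≤ n, (((A ^ j) a' : K) : E) = (S ^ j) a := by
    intro j
    induction j with
    | zero => intro _; simp [a']
    | succ j ih =>
      intro hj
      have h1 := ih (by omega)
      have h2 : (A ^ (j + 1)) a' = K.orthogonalProjectionOnto (S ((A ^ j) a' : K)) := by
        rw [pow_succ']; rfl
      have h3 : S ((A ^ j) a' : K) = (S ^ (j + 1)) a := by rw [h1, pow_succ']; rfl
      rw [h2, h3]
      exact congrArg Subtype.val (K.orthogonalProjectionOnto_mem_subspace_eq_self ⟨_, hmem _ hj⟩)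
  let b := hA.eigenvectorBasis rfl
  let l := hA.eigenvalues rfl
  have hb : ∀ i, A (b i) = (l i : 𝕜) • b i := fun i => hA.apply_eigenvectorBasis rfl i
  have hl : ∀ i, |l i| ≤ ‖S‖ := by
    intro i
    have h1 : ‖A (b i)‖ ≤ ‖S‖ := by
      have : ‖S (b i : E)‖ ≤ ‖S‖ := by
        refine (S.le_opNorm _).trans ?_
        have : ‖(b i : E)‖ = 1 := b.orthonormal.1 i
        rw [this, mul_one]
      exact (K.norm_orthogonalProjectionOnto_apply_le _).trans this
    have h2 : ‖b i‖ = 1 := b.orthonormal.1 i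
    rw [hb, norm_smul, h2, mul_one, RCLike.norm_ofReal] at h1
    exact h1
  have hbpow : ∀ j i, (A ^ j) (b i) = ((l i ^ j : ℝ) : 𝕜) • b i := by
    intro j i
    induction j with
    | zero => simp
    | succ j ih =>
      rw [pow_succ', mul_apply_eq_comp, ih, map_smul, hb, smul_smul]
      push_cast; ring_nf
  have hinner : ∀ j, inner 𝕜 a' ((A ^ j) a') =
      ((∑ i, ‖inner 𝕜 (b i) a'‖ ^ 2 * l i ^ j : ℝ) : 𝕜) := by
    intro j
    conv_lhs => rw [← b.sum_repr' a', map_sum, inner_sum]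
    rw [RCLike.ofReal_sum]
    refine Finset.sum_congr rfl fun i _ => ?_
    rw [map_smul, hbpow, inner_smul_right, inner_smul_right, b.sum_repr' a',
      ← inner_conj_symm a' (b i)]
    push_cast
    rw [← RCLike.mul_conj]
    ring
  let x : Fin (Module.finrank 𝕜 K) → Set.Icc (-‖S‖) ‖S‖ := fun i => ⟨l i, abs_le.1 (hl i)⟩
  let c : Fin (Module.finrank 𝕜 K) → ℝ≥0 := fun i => ‖inner 𝕜 (b i) a'‖₊ ^ 2
  let μ : Measure (Set.Icc (-‖S‖) ‖S‖) := ∑ i, c i • Measure.dirac (x i)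
  have hμuniv : μ Set.univ = ((‖a‖₊ ^ 2 : ℝ≥0) : ENNReal) := by
    have h1 : ∑ i, c i = ‖a‖₊ ^ 2 := by
      apply NNReal.coe_injective
      push_cast
      exact b.sum_sq_norm_inner_right a'
    simp only [μ, Measure.coe_finsetSum, Finset.sum_apply, Measure.smul_apply, measure_univ]
    rw [← h1]
    simp [ENNReal.smul_def]
  have : IsFiniteMeasure μ := ⟨by rw [hμuniv]; exact ENNReal.coe_lt_top⟩
  refine ⟨⟨μ, inferInstance⟩, ?_, fun j hj => ?_⟩
  · exact ENNReal.coe_le_coe.1 (FiniteMeasure.ennreal_mass.trans_le hμuniv.le)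
  · have h1 : ∫ t, (t : ℝ) ^ j ∂μ = ∑ i, ‖inner 𝕜 (b i) a'‖ ^ 2 * l i ^ j := by
      rw [integral_finsetSum_measure]
      · refine Finset.sum_congr rfl fun i _ => ?_
        rw [integral_smul_nnreal_measure, integral_dirac]
        rfl
      · intro i _
        exact (integrable_dirac (by simp)).smul_measure_nnreal
    rw [FiniteMeasure.toMeasure_mk, h1, ← hinner, ← hpow j hj]
    rfl

/-- A symmetric operator has a moment measure on `[-‖S‖, ‖S‖]` at every vector: a weak limit
point of the measures with the correct moments up to order `n`. -/
theorem exists_measure_moments (S : E →L[𝕜] E) (hS : (S : E →ₗ[𝕜] E).IsSymmetric) (a : E) :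
    ∃ μ : Measure ℝ, IsFiniteMeasure μ ∧ (∀ᵐ t ∂μ, |t| ≤ ‖S‖) ∧
      ∀ n : ℕ, ((∫ t, t ^ n ∂μ : ℝ) : 𝕜) = inner 𝕜 a ((S ^ n) a) := by
  choose ν hν1 hν2 using exists_finiteMeasure_truncated_moments S hS a
  obtain ⟨μ, -, hμ⟩ := (isCompact_setOfPred_finiteMeasure_le_of_compactSpace
    (Set.Icc (-‖S‖) ‖S‖) (‖a‖₊ ^ 2)).exists_mapClusterPt (f := atTop) (u := ν)
    (by simpa using ⟨0, fun n _ => hν1 n⟩)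
  obtain ⟨U, hU, hUμ⟩ := mapClusterPt_iff_ultrafilter.1 hμ
  refine ⟨(μ : Measure (Set.Icc (-‖S‖) ‖S‖)).map Subtype.val, inferInstance, ?_, fun n => ?_⟩
  · rw [ae_map_iff measurable_subtype_coe.aemeasurable
      (measurableSet_le (by fun_prop) measurable_const)]
    exact .of_forall fun t => abs_le.2 t.2
  · rw [integral_map measurable_subtype_coe.aemeasurable (by fun_prop)]
    let f : BoundedContinuousFunction (Set.Icc (-‖S‖) ‖S‖) ℝ :=
      BoundedContinuousFunction.mkOfCompact ⟨fun t => (t : ℝ) ^ n, by fun_prop⟩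
    have h1 : Tendsto (fun m => ∫ t, f t ∂(ν m : Measure (Set.Icc (-‖S‖) ‖S‖))) U
        (𝓝 (∫ t, f t ∂(μ : Measure (Set.Icc (-‖S‖) ‖S‖)))) :=
      FiniteMeasure.tendsto_iff_forall_integral_tendsto.1 hUμ f
    have h2 : Tendsto (fun m => ((∫ t, f t ∂(ν m : Measure (Set.Icc (-‖S‖) ‖S‖)) : ℝ) : 𝕜)) U
        (𝓝 ((∫ t, f t ∂(μ : Measure (Set.Icc (-‖S‖) ‖S‖)) : ℝ) : 𝕜)) :=
      (RCLike.continuous_ofReal.tendsto _).comp h1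
    have h3 : Tendsto (fun m => ((∫ t, f t ∂(ν m : Measure (Set.Icc (-‖S‖) ‖S‖)) : ℝ) : 𝕜)) U
        (𝓝 (inner 𝕜 a ((S ^ n) a))) :=
      tendsto_const_nhds.congr' (((eventually_ge_atTop n).filter_mono hU).mono fun m hm => (hν2 m n hm).symm)
    exact tendsto_nhds_unique h2 h3

theorem spectrum_ofReal_abs_le [CompleteSpace E] {S : E →L[𝕜] E} {t : ℝ}
    (ht : (t : 𝕜) ∈ spectrum 𝕜 S) : |t| ≤ ‖S‖ := by
  have h := spectrum.norm_le_norm_mul_of_mem ht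
  rw [RCLike.norm_ofReal] at h
  exact h.trans (mul_le_of_le_one_right (norm_nonneg _) ContinuousLinearMap.norm_id_le)

theorem IsSpectralMeasureAt.ae_abs_le [CompleteSpace E] {S : E →L[𝕜] E} {a : E} {μ : Measure ℝ}
    (hμ : IsSpectralMeasureAt S a μ) : ∀ᵐ t ∂μ, |t| ≤ ‖S‖ := by
  have h : ∀ᵐ t ∂μ, ((t : ℝ) : 𝕜) ∈ spectrum 𝕜 S := by
    rw [ae_iff]; exact hμ.supported
  exact h.mono fun t ht => spectrum_ofReal_abs_le ht

/-- Moment measures do not charge the resolvent set: if `V` inverts `r - S`, then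
`‖p‖ ≤ ‖V‖ ‖(r - t) p‖` in `L²(μ)` for polynomials, hence for the indicator function of a small
interval around `r`, which forces that interval to be null. -/
theorem measure_ball_eq_zero_of_moments [CompleteSpace E] {S : E →L[𝕜] E} (hS : IsSelfAdjoint S)
    {a : E} {μ : Measure ℝ} [IsFiniteMeasure μ] {R : ℝ} (hR : ∀ᵐ t ∂μ, |t| ≤ R)
    (hm : ∀ n : ℕ, ((∫ t, t ^ n ∂μ : ℝ) : 𝕜) = inner 𝕜 a ((S ^ n) a)) {r : ℝ}
    (hr : (r : 𝕜) ∉ spectrum 𝕜 S) : ∃ δ > 0, μ (Metric.ball r δ) = 0 := by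
  obtain ⟨w, hw⟩ := spectrum.notMem_iff.1 hr
  let V : E →L[𝕜] E := (w⁻¹ : (E →L[𝕜] E)ˣ)
  have hV : V * polyOp S (Polynomial.C r - Polynomial.X) = 1 := by
    rw [map_sub, polyOp_C, polyOp_X, ← Algebra.algebraMap_eq_smul_one, ← hw]
    exact w.inv_mul
  -- `p(S) a = V ((r - S) p(S) a)`, read in `L²(μ)`
  have hpoly : ∀ p : Polynomial ℝ, eLpNorm (fun t => p.eval t) 2 μ ≤
      ‖V‖ₑ * eLpNorm (fun t => (r - t) * p.eval t) 2 μ := by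
    intro p
    have h1 : polyOp S p a = V (polyOp S ((Polynomial.C r - Polynomial.X) * p) a) := by
      rw [map_mul, ← mul_apply_eq_comp, ← mul_assoc, hV, one_mul]
    have h2 := enorm_polyOp_of_moments hS hR hm ((Polynomial.C r - Polynomial.X) * p)
    simp only [Polynomial.eval_mul, Polynomial.eval_sub, Polynomial.eval_C,
      Polynomial.eval_X] at h2
    rw [← enorm_polyOp_of_moments hS hR hm p, h1, ← h2]
    exact V.le_opENorm _
  -- with `‖V‖ δ < 1`, the inequality for the indicator of the `δ`-ball contradicts a positive norm
  obtain ⟨δ, hδ, hδV⟩ : ∃ δ : ℝ≥0, 0 < δ ∧ ‖V‖₊ * δ < 1 := by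
    refine ⟨(‖V‖₊ + 1)⁻¹, by positivity, ?_⟩
    rw [← div_eq_mul_inv, div_lt_one (by positivity)]
    exact lt_add_one _
  refine ⟨δ, hδ, ?_⟩
  let f : ℝ → ℝ := (Metric.ball r δ).indicator fun _ => 1
  have hfm : Measurable f := measurable_const.indicator Metric.isOpen_ball.measurableSet
  have hf : IsLocallyBoundedBorel f :=
    ⟨hfm, fun _ => ⟨1, fun t _ => by
      by_cases h : t ∈ Metric.ball r δ <;> simp [f, h]⟩⟩
  have hl : IsLocallyBoundedBorel fun t : ℝ => r - t := .of_continuous (by fun_prop)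
  obtain ⟨M, hM⟩ := hl.exists_eLpNorm_mul_le hR
  obtain ⟨p, hp⟩ := exists_seq_polynomial_tendsto hR (hf.memLp hR 2)
  have h1 : eLpNorm f 2 μ ≤ ‖V‖ₑ * eLpNorm (fun t => (r - t) * f t) 2 μ := by
    set d : ℕ → ENNReal := fun n => eLpNorm (fun t => f t - (p n).eval t) 2 μ with hd
    have h2 : ∀ n, eLpNorm f 2 μ ≤
        d n + ‖V‖ₑ * (M * d n + eLpNorm (fun t => (r - t) * f t) 2 μ) := by
      intro n
      have h3 : eLpNorm f 2 μ ≤ d n + eLpNorm (fun t => (p n).eval t) 2 μ := by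
        simpa using eLpNorm_sub_le_add (μ := μ) hfm (p n).continuous.measurable
          (measurable_const (a := (0 : ℝ)))
      have h4 : eLpNorm (fun t => (r - t) * (p n).eval t) 2 μ ≤
          M * d n + eLpNorm (fun t => (r - t) * f t) 2 μ := by
        have h5 := eLpNorm_sub_le_add (μ := μ)
          (hl.mul (.polynomial (p n))).measurable (hl.mul hf).measurable
          (measurable_const (a := (0 : ℝ)))
        simp only [sub_zero] at h5
        refine h5.trans (add_le_add_left ?_ _)
        rw [eLpNorm_sub_rev]
        simp_rw [← mul_sub]
        exact hM _
      exact h3.trans (add_le_add_right ((hpoly (p n)).trans (mul_le_mul_right h4 _)) _)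
    have h6 : Tendsto (fun n => d n + ‖V‖ₑ * (M * d n + eLpNorm (fun t => (r - t) * f t) 2 μ))
        atTop (𝓝 (0 + ‖V‖ₑ * (M * 0 + eLpNorm (fun t => (r - t) * f t) 2 μ))) :=
      hp.add (ENNReal.Tendsto.const_mul
        ((ENNReal.Tendsto.const_mul hp (Or.inr ENNReal.coe_ne_top)).add tendsto_const_nhds)
        (Or.inr (by simp)))
    simpa using ge_of_tendsto' h6 h2
  have h2 : eLpNorm (fun t => (r - t) * f t) 2 μ ≤ δ * eLpNorm f 2 μ := by
    refine eLpNorm_le_nnreal_smul_eLpNorm_of_ae_le_mul (.of_forall fun t => ?_) 2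
    by_cases h : t ∈ Metric.ball r δ
    · have h' : |r - t| ≤ δ := by
        rw [Metric.mem_ball, Real.dist_eq, abs_sub_comm] at h; exact h.le
      rw [nnnorm_mul]
      gcongr
      exact h'
    · simp [f, h]
  have h3 : eLpNorm f 2 μ = 0 := by
    by_contra h0
    have htop : eLpNorm f 2 μ ≠ ⊤ := (hf.memLp hR 2).2.ne
    have h4 : eLpNorm f 2 μ ≤ ((‖V‖₊ * δ : ℝ≥0) : ENNReal) * eLpNorm f 2 μ := by
      refine h1.trans ((mul_le_mul_right h2 _).trans ?_)
      rw [ENNReal.coe_mul, mul_assoc]; rfl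
    have h5 : ((‖V‖₊ * δ : ℝ≥0) : ENNReal) * eLpNorm f 2 μ < 1 * eLpNorm f 2 μ :=
      ENNReal.mul_lt_mul_left h0 htop (by exact_mod_cast hδV)
    rw [one_mul] at h5
    exact absurd h5 (not_lt.2 h4)
  rw [eLpNorm_eq_zero_iff hfm.aestronglyMeasurable (by norm_num)] at h3
  refine measure_mono_null (fun t ht => ?_) (ae_iff.1 h3)
  have h4 : f t = 1 := Set.indicator_of_mem ht _
  simp [h4]

theorem exists_isSpectralMeasureAt [CompleteSpace E] {S : E →L[𝕜] E} (hS : IsSelfAdjoint S)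
    (a : E) : ∃ μ : Measure ℝ, IsSpectralMeasureAt S a μ := by
  obtain ⟨μ, hfin, hR, hm⟩ :=
    exists_measure_moments S (ContinuousLinearMap.isSelfAdjoint_iff_isSymmetric.1 hS) a
  refine ⟨μ, hfin, measure_null_of_locally_null _ fun r hr => ?_, hm⟩
  obtain ⟨δ, hδ, h0⟩ := measure_ball_eq_zero_of_moments hS hR hm hr
  exact ⟨_, mem_nhdsWithin_of_mem_nhds (Metric.ball_mem_nhds r hδ), h0⟩

theorem IsSpectralMeasureAt.integral_polynomial [CompleteSpace E] {S : E →L[𝕜] E} {a : E}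
    {μ : Measure ℝ} (hμ : IsSpectralMeasureAt S a μ) (p : Polynomial ℝ) :
    ((∫ t, p.eval t ∂μ : ℝ) : 𝕜) = inner 𝕜 a (polyOp S p a) :=
  have := hμ.finite
  integral_polynomial_of_moments hμ.ae_abs_le hμ.moments p

theorem IsSpectralMeasureAt.enorm_polyOp [CompleteSpace E] {S : E →L[𝕜] E} (hS : IsSelfAdjoint S)
    {a : E} {μ : Measure ℝ} (hμ : IsSpectralMeasureAt S a μ) (p : Polynomial ℝ) :
    ‖polyOp S p a‖ₑ = eLpNorm (fun t => p.eval t) 2 μ :=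
  have := hμ.finite
  enorm_polyOp_of_moments hS hμ.ae_abs_le hμ.moments p

theorem IsSpectralMeasureAt.unique [CompleteSpace E] {S : E →L[𝕜] E} {a : E} {μ ν : Measure ℝ}
    (hμ : IsSpectralMeasureAt S a μ) (hν : IsSpectralMeasureAt S a ν) : μ = ν := by
  have := hμ.finite
  have := hν.finite
  refine measure_eq_of_integral_polynomial_eq hμ.ae_abs_le hν.ae_abs_le fun p => ?_
  have h := (hμ.integral_polynomial p).trans (hν.integral_polynomial p).symm
  exact_mod_cast h

end SpectralMeasure

/-! ### The Borel functional calculus as a limit of polynomials -/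

section BorelCalculus

variable {𝕜 : Type*} [RCLike 𝕜] {E : Type*} [NormedAddCommGroup E] [InnerProductSpace 𝕜 E]

/-- `y` is the vector `f(S) a`: its distance to every `p(S) a`, `p` a polynomial, is the distance
of `f` to `p` in `L²` of the spectral measure at `a`. -/
def IsCalculusVector (S : E →L[𝕜] E) (f : ℝ → ℝ) (a y : E) : Prop :=
  ∀ μ : Measure ℝ, IsSpectralMeasureAt S a μ → ∀ p : Polynomial ℝ,
    ‖y - polyOp S p a‖ₑ = eLpNorm (fun t => f t - p.eval t) 2 μ

/-- The sequences `p n (S) a` converge to `f(S) a` as soon as `p n` converges to `f` in `L²`. -/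
theorem IsCalculusVector.tendsto {S : E →L[𝕜] E} {f : ℝ → ℝ} {a y : E}
    (hy : IsCalculusVector S f a y) {μ ν : Measure ℝ} (hμ : IsSpectralMeasureAt S a μ)
    (hle : μ ≤ ν) {p : ℕ → Polynomial ℝ}
    (hp : Tendsto (fun n => eLpNorm (fun t => f t - (p n).eval t) 2 ν) atTop (𝓝 0)) :
    Tendsto (fun n => polyOp S (p n) a) atTop (𝓝 y) := by
  rw [tendsto_iff_edist_tendsto_0]
  refine tendsto_of_tendsto_of_tendsto_of_le_of_le tendsto_const_nhds hp (fun _ => zero_le)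
    fun n => ?_
  simp only []
  rw [edist_comm, edist_eq_enorm_sub, hy μ hμ]
  exact eLpNorm_mono_measure _ hle

theorem IsCalculusVector.enorm_eq {S : E →L[𝕜] E} {f : ℝ → ℝ} {a y : E}
    (hy : IsCalculusVector S f a y) {μ : Measure ℝ} (hμ : IsSpectralMeasureAt S a μ) :
    ‖y‖ₑ = eLpNorm f 2 μ := by
  simpa using hy μ hμ 0

variable [CompleteSpace E]

theorem exists_isCalculusVector {S : E →L[𝕜] E} (hS : IsSelfAdjoint S) {f : ℝ → ℝ}
    (hf : IsLocallyBoundedBorel f) (a : E) : ∃ y, IsCalculusVector S f a y := by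
  obtain ⟨μ, hμ⟩ := exists_isSpectralMeasureAt hS a
  have := hμ.finite
  obtain ⟨p, hp⟩ := exists_seq_polynomial_tendsto hμ.ae_abs_le (hf.memLp hμ.ae_abs_le 2)
  have hdist : ∀ q r : Polynomial ℝ, edist (polyOp S q a) (polyOp S r a) =
      eLpNorm (fun t => q.eval t - r.eval t) 2 μ := by
    intro q r
    rw [edist_eq_enorm_sub, ← sub_apply, ← map_sub, hμ.enorm_polyOp hS]
    simp only [Polynomial.eval_sub]
  have hcau : CauchySeq fun n => polyOp S (p n) a := by
    rw [EMetric.cauchySeq_iff]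
    intro ε hε
    obtain ⟨N, hN⟩ := eventually_atTop.1 (hp.eventually (gt_mem_nhds (ENNReal.half_pos hε.ne')))
    refine ⟨N, fun m hm n hn => ?_⟩
    rw [hdist]
    refine (eLpNorm_sub_le_add (p m).continuous.measurable hf.measurable
      (p n).continuous.measurable).trans_lt ?_
    rw [eLpNorm_sub_rev, ← ENNReal.add_halves ε]
    exact ENNReal.add_lt_add (hN m hm) (hN n hn)
  obtain ⟨y, hy⟩ := cauchySeq_tendsto_of_complete hcau
  refine ⟨y, fun ν hν q => ?_⟩
  rw [hν.unique hμ]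
  have h1 : Tendsto (fun n => edist (polyOp S (p n) a) (polyOp S q a)) atTop
      (𝓝 (edist y (polyOp S q a))) := hy.edist tendsto_const_nhds
  rw [← edist_eq_enorm_sub]
  simp_rw [hdist] at h1
  refine le_antisymm ?_ ?_
  · have h2 := hp.add (tendsto_const_nhds (x := eLpNorm (fun t => f t - q.eval t) 2 μ))
    rw [zero_add] at h2
    refine le_of_tendsto_of_tendsto' h1 h2 fun n => ?_
    rw [eLpNorm_sub_rev f (fun t => (p n).eval t)]
    exact eLpNorm_sub_le_add (p n).continuous.measurable hf.measurable q.continuous.measurable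
  · have h2 := hp.add h1
    rw [zero_add] at h2
    exact ge_of_tendsto' h2 fun n =>
      eLpNorm_sub_le_add hf.measurable (p n).continuous.measurable q.continuous.measurable

/-- `F` is the operator `f(S)`, characterised by its distance to polynomials in `S` at every
vector. -/
def IsCalculusOp (S : E →L[𝕜] E) (f : ℝ → ℝ) (F : E →L[𝕜] E) : Prop :=
  ∀ a : E, IsCalculusVector S f a (F a)

theorem isCalculusOp_polyOp {S : E →L[𝕜] E} (hS : IsSelfAdjoint S) (p : Polynomial ℝ) :
    IsCalculusOp S (fun t => p.eval t) (polyOp S p) := by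
  intro a μ hμ q
  rw [← sub_apply, ← map_sub, hμ.enorm_polyOp hS]
  simp only [Polynomial.eval_sub]

theorem IsSpectralMeasureAt.norm_le {S : E →L[𝕜] E} (hS : IsSelfAdjoint S) {f : ℝ → ℝ} {a y : E}
    (hy : IsCalculusVector S f a y) {μ : Measure ℝ} (hμ : IsSpectralMeasureAt S a μ) {C : ℝ≥0}
    (hC : ∀ᵐ t ∂μ, |f t| ≤ C) : ‖y‖ ≤ C * ‖a‖ := by
  have h1 : ‖a‖ₑ = eLpNorm (fun _ => (1 : ℝ)) 2 μ := by
    simpa using hμ.enorm_polyOp hS 1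
  have h2 : eLpNorm f 2 μ ≤ C * eLpNorm (fun _ => (1 : ℝ)) 2 μ := by
    refine eLpNorm_le_nnreal_smul_eLpNorm_of_ae_le_mul (hC.mono fun t ht => ?_) 2
    simpa using! ht
  rw [← h1, ← hy.enorm_eq hμ] at h2
  have h3 : ‖y‖₊ ≤ C * ‖a‖₊ := ENNReal.coe_le_coe.1 (by rw [ENNReal.coe_mul]; exact h2)
  exact_mod_cast h3

theorem IsCalculusVector.norm_le {S : E →L[𝕜] E} (hS : IsSelfAdjoint S) {f : ℝ → ℝ} {a y : E}
    (hy : IsCalculusVector S f a y) {C : ℝ≥0} (hC : ∀ t, |t| ≤ ‖S‖ → |f t| ≤ C) :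
    ‖y‖ ≤ C * ‖a‖ := by
  obtain ⟨μ, hμ⟩ := exists_isSpectralMeasureAt hS a
  exact hμ.norm_le hS hy (hμ.ae_abs_le.mono hC)

/-- Every locally bounded Borel function of a self-adjoint operator exists. Linearity is inherited
from polynomials by approximating in `L²(μ_a + μ_b + μ_{a+b})`. -/
theorem exists_isCalculusOp {S : E →L[𝕜] E} (hS : IsSelfAdjoint S) {f : ℝ → ℝ}
    (hf : IsLocallyBoundedBorel f) : ∃ F : E →L[𝕜] E, IsCalculusOp S f F := by
  choose F hF using exists_isCalculusVector hS hf
  obtain ⟨C, hC⟩ := hf.bounded ‖S‖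
  refine ⟨LinearMap.mkContinuous
    { toFun := F, map_add' := fun a b => ?_, map_smul' := fun c a => ?_ }
    C fun a => (hF a).norm_le hS hC, hF⟩
  · obtain ⟨μ, hμ⟩ := exists_isSpectralMeasureAt hS a
    obtain ⟨ν, hν⟩ := exists_isSpectralMeasureAt hS b
    obtain ⟨ρ, hρ⟩ := exists_isSpectralMeasureAt hS (a + b)
    have := hμ.finite
    have := hν.finite
    have := hρ.finite
    have hR : ∀ᵐ t ∂(μ + ν + ρ), |t| ≤ ‖S‖ := by
      simp only [ae_add_measure_iff]
      exact ⟨⟨hμ.ae_abs_le, hν.ae_abs_le⟩, hρ.ae_abs_le⟩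
    obtain ⟨p, hp⟩ := exists_seq_polynomial_tendsto hR (hf.memLp hR 2)
    have h1 := (hF a).tendsto hμ
      ((Measure.le_add_right le_rfl).trans (Measure.le_add_right le_rfl)) hp
    have h2 := (hF b).tendsto hν
      ((Measure.le_add_left le_rfl).trans (Measure.le_add_right le_rfl)) hp
    have h3 := (hF (a + b)).tendsto hρ (Measure.le_add_left le_rfl) hp
    simp_rw [map_add] at h3
    exact tendsto_nhds_unique h3 (h1.add h2)
  · obtain ⟨μ, hμ⟩ := exists_isSpectralMeasureAt hS a
    obtain ⟨ρ, hρ⟩ := exists_isSpectralMeasureAt hS (c • a)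
    have := hμ.finite
    have := hρ.finite
    have hR : ∀ᵐ t ∂(μ + ρ), |t| ≤ ‖S‖ := by
      rw [ae_add_measure_iff]
      exact ⟨hμ.ae_abs_le, hρ.ae_abs_le⟩
    obtain ⟨p, hp⟩ := exists_seq_polynomial_tendsto hR (hf.memLp hR 2)
    have h1 := (hF a).tendsto hμ (Measure.le_add_right le_rfl) hp
    have h3 := (hF (c • a)).tendsto hρ (Measure.le_add_left le_rfl) hp
    simp_rw [map_smul] at h3
    exact tendsto_nhds_unique h3 (h1.const_smul c)

/-- The map `f ↦ f(S) a` is isometric from `L²` of the spectral measure. -/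
theorem IsCalculusVector.enorm_sub {S : E →L[𝕜] E} {f g : ℝ → ℝ} {a y z : E}
    (hf : IsLocallyBoundedBorel f) (hg : IsLocallyBoundedBorel g)
    (hy : IsCalculusVector S f a y) (hz : IsCalculusVector S g a z) {μ : Measure ℝ}
    (hμ : IsSpectralMeasureAt S a μ) :
    ‖y - z‖ₑ = eLpNorm (fun t => f t - g t) 2 μ := by
  have := hμ.finite
  obtain ⟨p, hp⟩ := exists_seq_polynomial_tendsto hμ.ae_abs_le (hg.memLp hμ.ae_abs_le 2)
  have h1 : Tendsto (fun n => ‖y - polyOp S (p n) a‖ₑ) atTop (𝓝 ‖y - z‖ₑ) :=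
    (tendsto_const_nhds.sub (hz.tendsto hμ le_rfl hp)).enorm
  simp_rw [hy μ hμ] at h1
  refine le_antisymm ?_ ?_
  · have h2 := (tendsto_const_nhds (x := eLpNorm (fun t => f t - g t) 2 μ)).add hp
    rw [add_zero] at h2
    exact le_of_tendsto_of_tendsto' h1 h2 fun n =>
      eLpNorm_sub_le_add hf.measurable hg.measurable (p n).continuous.measurable
  · have h2 := h1.add hp
    rw [add_zero] at h2
    refine ge_of_tendsto' h2 fun n => ?_
    rw [eLpNorm_sub_rev g]
    exact eLpNorm_sub_le_add hf.measurable (p n).continuous.measurable hg.measurable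

theorem IsCalculusVector.norm_sub_sq {S : E →L[𝕜] E} {f g : ℝ → ℝ} {a y z : E}
    (hf : IsLocallyBoundedBorel f) (hg : IsLocallyBoundedBorel g)
    (hy : IsCalculusVector S f a y) (hz : IsCalculusVector S g a z) {μ : Measure ℝ}
    (hμ : IsSpectralMeasureAt S a μ) :
    ‖y - z‖ ^ 2 = ∫ t, (f t - g t) ^ 2 ∂μ := by
  have := hμ.finite
  have h := ofReal_integral_sq ((hf.memLp hμ.ae_abs_le 2).sub (hg.memLp hμ.ae_abs_le 2))
  have h2 := hy.enorm_sub hf hg hz hμ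
  change _ = eLpNorm (fun t => f t - g t) 2 μ ^ 2 at h
  rw [← h2, ← ofReal_norm, ← ENNReal.ofReal_pow (norm_nonneg _)] at h
  exact ((ENNReal.ofReal_eq_ofReal_iff (integral_nonneg fun t => sq_nonneg _)
    (by positivity)).1 h).symm

theorem IsCalculusOp.unique {S : E →L[𝕜] E} (hS : IsSelfAdjoint S) {f : ℝ → ℝ}
    {F K : E →L[𝕜] E} (hf : IsLocallyBoundedBorel f) (hF : IsCalculusOp S f F)
    (hK : IsCalculusOp S f K) : F = K := by
  ext a
  obtain ⟨μ, hμ⟩ := exists_isSpectralMeasureAt hS a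
  have h := (hF a).enorm_sub hf hf (hK a) hμ
  simpa [sub_eq_zero] using h

theorem IsCalculusOp.isSymmetric {S : E →L[𝕜] E} (hS : IsSelfAdjoint S) {f : ℝ → ℝ}
    {F : E →L[𝕜] E} (hf : IsLocallyBoundedBorel f) (hF : IsCalculusOp S f F) :
    (F : E →ₗ[𝕜] E).IsSymmetric := by
  intro a b
  obtain ⟨μ, hμ⟩ := exists_isSpectralMeasureAt hS a
  obtain ⟨ν, hν⟩ := exists_isSpectralMeasureAt hS b
  have := hμ.finite
  have := hν.finite
  have hR : ∀ᵐ t ∂(μ + ν), |t| ≤ ‖S‖ := by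
    rw [ae_add_measure_iff]
    exact ⟨hμ.ae_abs_le, hν.ae_abs_le⟩
  obtain ⟨p, hp⟩ := exists_seq_polynomial_tendsto hR (hf.memLp hR 2)
  have h1 := ((hF a).tendsto hμ (Measure.le_add_right le_rfl) hp).inner
    (tendsto_const_nhds (x := b)) (𝕜 := 𝕜)
  have h2 := (tendsto_const_nhds (x := a)).inner
    ((hF b).tendsto hν (Measure.le_add_left le_rfl) hp) (𝕜 := 𝕜)
  simp_rw [inner_polyOp_left hS] at h1
  exact tendsto_nhds_unique h1 h2

theorem IsCalculusVector.inner_eq {S : E →L[𝕜] E} {f : ℝ → ℝ} {a y : E}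
    (hf : IsLocallyBoundedBorel f) (hy : IsCalculusVector S f a y) {μ : Measure ℝ}
    (hμ : IsSpectralMeasureAt S a μ) : inner 𝕜 a y = ((∫ t, f t ∂μ : ℝ) : 𝕜) := by
  have := hμ.finite
  obtain ⟨p, hp⟩ := exists_seq_polynomial_tendsto hμ.ae_abs_le (hf.memLp hμ.ae_abs_le 2)
  have h1 := (tendsto_const_nhds (x := a)).inner (hy.tendsto hμ le_rfl hp) (𝕜 := 𝕜)
  have h2 := (RCLike.continuous_ofReal (K := 𝕜)).continuousAt.tendsto.comp
    (tendsto_integral_of_tendsto_eLpNorm_two hμ.ae_abs_le hf (fun n => .polynomial (p n)) hp)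
  refine tendsto_nhds_unique h1 (h2.congr fun n => ?_)
  exact hμ.integral_polynomial (p n)

theorem IsCalculusOp.isBorelCalculus {S : E →L[𝕜] E} (hS : IsSelfAdjoint S) {f : ℝ → ℝ}
    {F : E →L[𝕜] E} (hf : IsLocallyBoundedBorel f) (hF : IsCalculusOp S f F) :
    IsBorelCalculus S f F := by
  refine ⟨ContinuousLinearMap.isSelfAdjoint_iff_isSymmetric.2 (hF.isSymmetric hS hf), fun a => ?_⟩
  obtain ⟨μ, hμ⟩ := exists_isSpectralMeasureAt hS a
  have := hμ.finite
  exact ⟨μ, hμ, hf.integrable hμ.ae_abs_le, (hF a).inner_eq hf hμ⟩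

theorem IsBorelCalculus.unique {S : E →L[𝕜] E} {f : ℝ → ℝ} {F K : E →L[𝕜] E}
    (hF : IsBorelCalculus S f F) (hK : IsBorelCalculus S f K) : F = K := by
  have hs := ContinuousLinearMap.isSelfAdjoint_iff_isSymmetric.1 (hF.1.sub hK.1)
  have h0 : ((F - K : E →L[𝕜] E) : E →ₗ[𝕜] E) = 0 := by
    refine hs.inner_map_self_eq_zero.1 fun a => ?_
    obtain ⟨μ, hμ, -, h1⟩ := hF.2 a
    obtain ⟨ν, hν, -, h2⟩ := hK.2 a
    rw [hs a a]
    change inner 𝕜 a (F a - K a) = 0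
    rw [inner_sub_right, h1, h2, hμ.unique hν, sub_self]
  ext a
  exact sub_eq_zero.1 (LinearMap.congr_fun h0 a)

theorem isCalculusOp_borelCalculus {S : E →L[𝕜] E} (hS : IsSelfAdjoint S) {f : ℝ → ℝ}
    (hf : IsLocallyBoundedBorel f) : IsCalculusOp S f (borelCalculus S f) := by
  obtain ⟨F, hF⟩ := exists_isCalculusOp hS hf
  have h : ∃ F, IsBorelCalculus S f F := ⟨F, hF.isBorelCalculus hS hf⟩
  rw [borelCalculus, dif_pos h, h.choose_spec.unique (hF.isBorelCalculus hS hf)]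
  exact hF

/-- The functional calculus is multiplicative: both factors are replaced by polynomials, the left
one in `L²(μ_a + μ_{g(S) a})`, so that no formula for the measure `μ_{g(S) a}` is needed. -/
theorem IsCalculusOp.mul {S : E →L[𝕜] E} (hS : IsSelfAdjoint S) {f g : ℝ → ℝ} {F K : E →L[𝕜] E}
    (hf : IsLocallyBoundedBorel f) (hg : IsLocallyBoundedBorel g) (hF : IsCalculusOp S f F)
    (hK : IsCalculusOp S g K) : IsCalculusOp S (fun t => f t * g t) (F * K) := by
  intro a μ hμ q
  have := hμ.finite
  have hR := hμ.ae_abs_le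
  -- the case of a polynomial left factor
  have hleft : ∀ r : Polynomial ℝ, ‖polyOp S r (K a) - polyOp S q a‖ₑ =
      eLpNorm (fun t => r.eval t * g t - q.eval t) 2 μ := by
    intro r
    obtain ⟨p, hp⟩ := exists_seq_polynomial_tendsto hR (hg.memLp hR 2)
    have h1 : Tendsto (fun n => ‖polyOp S r (polyOp S (p n) a) - polyOp S q a‖ₑ) atTop
        (𝓝 ‖polyOp S r (K a) - polyOp S q a‖ₑ) :=
      ((((polyOp S r).continuous.tendsto _).comp ((hK a).tendsto hμ le_rfl hp)).sub
        tendsto_const_nhds).enorm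
    obtain ⟨C, hC⟩ := (IsLocallyBoundedBorel.polynomial r).exists_eLpNorm_mul_le hR
    have hd := ENNReal.Tendsto.const_mul hp (a := C) (Or.inr ENNReal.coe_ne_top)
    rw [mul_zero] at hd
    have hd' : ∀ n, eLpNorm (fun t => r.eval t * g t - r.eval t * (p n).eval t) 2 μ ≤
        C * eLpNorm (fun t => g t - (p n).eval t) 2 μ := by
      intro n
      simp_rw [← mul_sub]
      exact hC _
    have h2 : ∀ n, ‖polyOp S r (polyOp S (p n) a) - polyOp S q a‖ₑ =
        eLpNorm (fun t => r.eval t * (p n).eval t - q.eval t) 2 μ := by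
      intro n
      rw [← mul_apply_eq_comp, ← map_mul, isCalculusOp_polyOp hS _ a μ hμ]
      simp only [Polynomial.eval_mul]
    simp_rw [h2] at h1
    have hrg := ((IsLocallyBoundedBorel.polynomial r).mul hg).measurable
    have hrp := fun n => ((IsLocallyBoundedBorel.polynomial r).mul (.polynomial (p n))).measurable
    refine le_antisymm ?_ ?_
    · have h3 := hd.add
        (tendsto_const_nhds (x := eLpNorm (fun t => r.eval t * g t - q.eval t) 2 μ))
      rw [zero_add] at h3
      refine le_of_tendsto_of_tendsto' h1 h3 fun n =>
        (eLpNorm_sub_le_add (hrp n) hrg q.continuous.measurable).trans ?_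
      gcongr
      rw [eLpNorm_sub_rev]
      exact hd' n
    · have h3 := hd.add h1
      rw [zero_add] at h3
      refine ge_of_tendsto' h3 fun n =>
        (eLpNorm_sub_le_add hrg (hrp n) q.continuous.measurable).trans ?_
      gcongr
      exact hd' n
  obtain ⟨ν, hν⟩ := exists_isSpectralMeasureAt hS (K a)
  have := hν.finite
  have hR' : ∀ᵐ t ∂(μ + ν), |t| ≤ ‖S‖ := by
    rw [ae_add_measure_iff]
    exact ⟨hR, hν.ae_abs_le⟩
  obtain ⟨r, hr⟩ := exists_seq_polynomial_tendsto hR' (hf.memLp hR' 2)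
  have h1 : Tendsto (fun n => ‖polyOp S (r n) (K a) - polyOp S q a‖ₑ) atTop
      (𝓝 ‖(F * K) a - polyOp S q a‖ₑ) :=
    (((hF (K a)).tendsto hν (Measure.le_add_left le_rfl) hr).sub tendsto_const_nhds).enorm
  simp_rw [hleft] at h1
  obtain ⟨C, hC⟩ := hg.exists_eLpNorm_mul_le hR
  have hd := ENNReal.Tendsto.const_mul hr (a := C) (Or.inr ENNReal.coe_ne_top)
  rw [mul_zero] at hd
  have hd' : ∀ n, eLpNorm (fun t => f t * g t - (r n).eval t * g t) 2 μ ≤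
      C * eLpNorm (fun t => f t - (r n).eval t) 2 (μ + ν) := by
    intro n
    simp_rw [← sub_mul, mul_comm _ (g _)]
    refine (hC _).trans ?_
    gcongr
    exact Measure.le_add_right le_rfl
  have hfg := (hf.mul hg).measurable
  have hrg := fun n => ((IsLocallyBoundedBorel.polynomial (r n)).mul hg).measurable
  refine le_antisymm ?_ ?_
  · have h3 := hd.add
      (tendsto_const_nhds (x := eLpNorm (fun t => f t * g t - q.eval t) 2 μ))
    rw [zero_add] at h3
    refine le_of_tendsto_of_tendsto' h1 h3 fun n =>
      (eLpNorm_sub_le_add (hrg n) hfg q.continuous.measurable).trans ?_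
    gcongr
    rw [eLpNorm_sub_rev]
    exact hd' n
  · have h3 := hd.add h1
    rw [zero_add] at h3
    refine ge_of_tendsto' h3 fun n =>
      (eLpNorm_sub_le_add hfg (hrg n) q.continuous.measurable).trans ?_
    gcongr
    exact hd' n

end BorelCalculus

/-! ### Recognising a Moore–Penrose pseudo-inverse -/

section MoorePenroseCriterion

variable {𝕜 : Type*} [RCLike 𝕜] {E : Type*} [NormedAddCommGroup E] [InnerProductSpace 𝕜 E]

theorem apply_mem_ker_orthogonal {S : E →L[𝕜] E} (hS : (S : E →ₗ[𝕜] E).IsSymmetric) (x : E) :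
    S x ∈ (LinearMap.ker (S : E →ₗ[𝕜] E))ᗮ := by
  intro k hk
  have h1 : inner 𝕜 (S k) x = inner 𝕜 k (S x) := hS k x
  have h2 : S k = 0 := hk
  rw [← h1, h2, inner_zero_left]

/-- A bounded operator that satisfies the Penrose equations with `S` and commutes with `S` is the
everywhere defined Moore–Penrose pseudo-inverse of `S`. -/
theorem moorePenrose_eq_toPMap [CompleteSpace E] {S P : E →L[𝕜] E} (hS : IsSelfAdjoint S)
    (hSPS : S * P * S = S) (hPSP : P * S * P = P) (hcomm : S * P = P * S) :
    moorePenrose S hS = (P : E →ₗ[𝕜] E).toPMap ⊤ := by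
  have hsymm := ContinuousLinearMap.isSelfAdjoint_iff_isSymmetric.1 hS
  have e1 : ∀ x, S (P (S x)) = S x := fun x => congrArg (fun L : E →L[𝕜] E => L x) hSPS
  have e2 : ∀ x, P (S (P x)) = P x := fun x => congrArg (fun L : E →L[𝕜] E => L x) hPSP
  have e3 : ∀ x, S (P x) = P (S x) := fun x => congrArg (fun L : E →L[𝕜] E => L x) hcomm
  refine LinearPMap.eq_of_le_of_domain_eq (LinearPMap.sup_le _ ?_ ?_) ?_
  · refine ⟨le_top, fun y z hyz => ?_⟩
    have hy : (y : E) ∈ LinearMap.range (restrictKerPerp S).toFun := by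
      rw [← LinearPMap.inverse_domain]; exact y.2
    obtain ⟨w, hw⟩ := hy
    have hw' : S (w : E) = y := hw
    rw [LinearPMap.inverse_apply_eq (restrictKerPerp_ker S) hw]
    change (w : E) = P (z : E)
    rw [← hyz, ← hw']
    have h1 : (w : E) - P (S w) ∈ LinearMap.ker (S : E →ₗ[𝕜] E) := by
      change S (w - P (S w)) = 0
      rw [map_sub, e1, sub_self]
    have h2 : (w : E) - P (S w) ∈ (LinearMap.ker (S : E →ₗ[𝕜] E))ᗮ := by
      rw [← e3]
      exact Submodule.sub_mem _ w.2 (apply_mem_ker_orthogonal hsymm _)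
    exact sub_eq_zero.1 (inner_self_eq_zero.1 (h2 _ h1))
  · refine ⟨le_top, fun y z hyz => ?_⟩
    have hy : S (y : E) = 0 := y.2
    change (0 : E) = P (z : E)
    rw [← hyz, ← e2, e3, hy, map_zero, map_zero]
  · change (restrictKerPerp S).inverse.domain ⊔ LinearMap.ker (S : E →ₗ[𝕜] E) = ⊤
    rw [eq_top_iff]
    intro z _
    rw [LinearPMap.inverse_domain]
    have hz : z = S (P z) + (z - S (P z)) := by abel
    rw [hz]
    refine Submodule.add_mem_sup ⟨⟨P z, ?_⟩, rfl⟩ ?_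
    · change P z ∈ (LinearMap.ker (S : E →ₗ[𝕜] E))ᗮ
      rw [← e2, ← e3]
      exact apply_mem_ker_orthogonal hsymm _
    · change S (z - S (P z)) = 0
      rw [map_sub, e3, e1, sub_self]

end MoorePenroseCriterion

/-! ### Piecewise continuous functions and their pseudo-inverse functions -/

section PiecewiseContinuous

/-- A piecewise continuous function has countably many discontinuities, so it is Borel. -/
theorem PiecewiseContinuous.measurable {f : ℝ≥0 → ℝ≥0} (hf : PiecewiseContinuous f) :
    Measurable f := by
  have hD : {x | ¬ ContinuousAt f x}.Countable := by
    have h : {x | ¬ ContinuousAt f x} = ⋃ n : ℕ, {x : ℝ≥0 | x ≤ n ∧ ¬ ContinuousAt f x} := by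
      ext x
      obtain ⟨n, hn⟩ := exists_nat_ge x
      simp only [Set.mem_ofPred_eq, Set.mem_iUnion]
      exact ⟨fun hx => ⟨n, hn, hx⟩, fun ⟨_, _, hx⟩ => hx⟩
    rw [h]
    exact Set.countable_iUnion fun n => (hf.1 n).countable
  refine measurable_of_restrict_of_restrict_compl hD.measurableSet ?_ ?_
  · have := hD.to_subtype
    exact measurable_of_countable _
  · have h : ContinuousOn f {x | ¬ ContinuousAt f x}ᶜ := fun x hx =>
      (not_not.1 hx : ContinuousAt f x).continuousWithinAt
    exact h.domRestrict.measurable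

/-- The one-sided limits bound `f` near each point; compactness of `[0, R]` does the rest. -/
theorem PiecewiseContinuous.bounded {f : ℝ≥0 → ℝ≥0} (hf : PiecewiseContinuous f) (R : ℝ≥0) :
    ∃ C : ℝ≥0, ∀ x ≤ R, f x ≤ C := by
  have h : ∃ C : ℝ≥0, ∀ x ∈ Set.Icc 0 R, f x ≤ C := by
    refine isCompact_Icc.induction_on (p := fun s => ∃ C : ℝ≥0, ∀ x ∈ s, f x ≤ C)
      ⟨0, fun x hx => hx.elim⟩ (fun s t hst ⟨C, hC⟩ => ⟨C, fun x hx => hC x (hst hx)⟩)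
      (fun s t ⟨C, hC⟩ ⟨D, hD⟩ => ⟨max C D, fun x hx => ?_⟩) (fun x _ => ?_)
    · rcases hx with hx | hx
      · exact (hC x hx).trans (le_max_left _ _)
      · exact (hD x hx).trans (le_max_right _ _)
    · obtain ⟨⟨l, hl⟩, ⟨m, hm⟩⟩ := hf.2 x
      have h1 : ∀ᶠ y in 𝓝 x, f y ≤ max (max (l + 1) (m + 1)) (f x) := by
        rw [← nhdsLT_sup_nhdsGE, ← Set.Ioi_insert, nhdsWithin_insert, eventually_sup,
          eventually_sup, eventually_pure]
        refine ⟨?_, le_max_right _ _, ?_⟩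
        · filter_upwards [hl.eventually (gt_mem_nhds (lt_add_one l))] with y hy
          exact hy.le.trans ((le_max_left _ _).trans (le_max_left _ _))
        · filter_upwards [hm.eventually (gt_mem_nhds (lt_add_one m))] with y hy
          exact hy.le.trans ((le_max_right _ _).trans (le_max_left _ _))
      exact ⟨_, mem_nhdsWithin_of_mem_nhds h1, _, fun y hy => hy⟩
  obtain ⟨C, hC⟩ := h
  exact ⟨C, fun x hx => hC x ⟨zero_le, hx⟩⟩

theorem PiecewiseContinuous.isLocallyBoundedBorel {f : ℝ≥0 → ℝ≥0} (hf : PiecewiseContinuous f) :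
    IsLocallyBoundedBorel (extendReal f) := by
  refine ⟨measurable_coe_nnreal_real.comp (hf.measurable.comp measurable_real_toNNReal),
    fun R => ?_⟩
  obtain ⟨C, hC⟩ := hf.bounded R.toNNReal
  refine ⟨C, fun t ht => ?_⟩
  rw [extendReal, NNReal.abs_eq]
  exact hC _ (Real.toNNReal_mono ((le_abs_self t).trans ht))

/-- The gap of `f` at `0` bounds its pseudo-inverse function by `1 / ε`. -/
theorem extendReal_pinvFun_le {f : ℝ≥0 → ℝ≥0} {ε : ℝ} (hε : 0 < ε)
    (h : ∀ t, f t = 0 ∨ ε ≤ (f t : ℝ)) (t : ℝ) :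
    |extendReal (pinvFun f) t| ≤ 1 / ε := by
  rw [extendReal, NNReal.abs_eq, pinvFun]
  rcases h t.toNNReal with h0 | h0
  · simp [h0, hε.le]
  · have h1 : f t.toNNReal ≠ 0 := fun h2 => by
      rw [h2, NNReal.coe_zero] at h0; exact absurd hε (not_lt.2 h0)
    rw [if_pos h1]
    push_cast
    gcongr

theorem isLocallyBoundedBorel_pinvFun {f : ℝ≥0 → ℝ≥0} (hf : PiecewiseContinuous f) {ε : ℝ}
    (hε : 0 < ε) (h : ∀ t, f t = 0 ∨ ε ≤ (f t : ℝ)) :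
    IsLocallyBoundedBorel (extendReal (pinvFun f)) := by
  have hm : Measurable (pinvFun f) := by
    refine Measurable.ite ?_ (measurable_const.div hf.measurable) measurable_const
    exact (hf.measurable (measurableSet_singleton 0)).compl
  refine ⟨measurable_coe_nnreal_real.comp (hm.comp measurable_real_toNNReal),
    fun R => ⟨(1 / ε).toNNReal, fun t _ => ?_⟩⟩
  exact (extendReal_pinvFun_le hε h t).trans (Real.le_coe_toNNReal _)

theorem extendReal_mul_pinvFun_mul (f : ℝ≥0 → ℝ≥0) (t : ℝ) :
    extendReal f t * extendReal (pinvFun f) t * extendReal f t = extendReal f t := by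
  simp only [extendReal, pinvFun]
  split_ifs with h
  · have h' : (f t.toNNReal : ℝ) ≠ 0 := by exact_mod_cast h
    push_cast; field_simp
  · simp [not_not.1 h]

theorem extendReal_pinvFun_mul_mul (f : ℝ≥0 → ℝ≥0) (t : ℝ) :
    extendReal (pinvFun f) t * extendReal f t * extendReal (pinvFun f) t =
      extendReal (pinvFun f) t := by
  simp only [extendReal, pinvFun]
  split_ifs with h
  · have h' : (f t.toNNReal : ℝ) ≠ 0 := by exact_mod_cast h
    push_cast; field_simp
  · simp

end PiecewiseContinuous

/-! ### Tikhonov regularisation and spectral cutoff -/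

section Examples

theorem piecewiseContinuous_of_continuous {f : ℝ≥0 → ℝ≥0} (hf : Continuous f) :
    PiecewiseContinuous f := by
  refine ⟨fun R => ?_, fun x => ⟨⟨f x, ?_⟩, ⟨f x, ?_⟩⟩⟩
  · simp [hf.continuousAt]
  · exact (hf.tendsto x).mono_left nhdsWithin_le_nhds
  · exact (hf.tendsto x).mono_left nhdsWithin_le_nhds

theorem isSpectralRegularisation_tikhonov : IsSpectralRegularisation tikhonov where
  piecewiseContinuous ε _ := piecewiseContinuous_of_continuous (by unfold tikhonov; fun_prop)
  gap ε hε t := by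
    right
    rw [tikhonov, NNReal.coe_add, Real.coe_toNNReal ε hε.le]
    exact le_add_of_nonneg_left t.2
  tendsto_one t ht := by
    have h1 : Tendsto (fun ε : ℝ => t / (t + ε.toNNReal)) (𝓝[>] 0)
        (𝓝 (t / (t + Real.toNNReal 0))) := by
      refine Tendsto.mono_left ?_ nhdsWithin_le_nhds
      refine Tendsto.div tendsto_const_nhds ?_ (by simpa using ht.ne')
      exact tendsto_const_nhds.add (continuous_real_toNNReal.tendsto 0)
    rw [Real.toNNReal_zero, add_zero, div_self ht.ne'] at h1
    refine h1.congr fun ε => ?_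
    have : t + ε.toNNReal ≠ 0 := (lt_add_of_lt_of_nonneg ht zero_le).ne'
    rw [pinvFun, tikhonov, if_pos this, mul_one_div]
  bounded := by
    refine ⟨1, fun ε hε t => ?_⟩
    have h : 0 < t + ε.toNNReal := lt_add_of_nonneg_of_lt zero_le (Real.toNNReal_pos.2 hε)
    rw [pinvFun, tikhonov, if_pos h.ne', mul_one_div, div_le_one h]
    exact le_self_add

theorem piecewiseContinuous_spectralCutoff {ε : ℝ} (hε : 0 < ε) :
    PiecewiseContinuous (spectralCutoff ε) := by
  lift ε to ℝ≥0 using hε.le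
  have hlt : ∀ x : ℝ≥0, x < ε → spectralCutoff ε x = 0 := fun x hx =>
    if_neg (not_lt.2 (NNReal.coe_le_coe.2 hx.le))
  have hgt : ∀ x : ℝ≥0, ε < x → spectralCutoff ε x = x := fun x hx =>
    if_pos (NNReal.coe_lt_coe.2 hx)
  have hcont : ∀ x : ℝ≥0, x ≠ ε → ContinuousAt (spectralCutoff ε) x := by
    intro x hx
    rcases lt_or_gt_of_ne hx with h | h
    · refine (continuousAt_const (y := (0 : ℝ≥0))).congr ?_
      filter_upwards [gt_mem_nhds h] with y hy using (hlt y hy).symm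
    · refine continuousAt_id.congr ?_
      filter_upwards [lt_mem_nhds h] with y hy using (hgt y hy).symm
  refine ⟨fun R => (Set.finite_singleton ε).subset fun x hx => ?_, fun x => ?_⟩
  · by_contra h
    exact hx.2 (hcont x h)
  · by_cases h : x = ε
    · subst h
      refine ⟨⟨0, tendsto_const_nhds.congr' ?_⟩, ⟨x, ?_⟩⟩
      · filter_upwards [self_mem_nhdsWithin] with y hy using (hlt y hy).symm
      · refine (tendsto_id.mono_left nhdsWithin_le_nhds).congr' ?_
        filter_upwards [self_mem_nhdsWithin] with y hy using (hgt y hy).symm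
    · exact ⟨⟨_, (hcont x h).tendsto.mono_left nhdsWithin_le_nhds⟩,
        ⟨_, (hcont x h).tendsto.mono_left nhdsWithin_le_nhds⟩⟩

theorem isSpectralRegularisation_spectralCutoff : IsSpectralRegularisation spectralCutoff where
  piecewiseContinuous ε hε := piecewiseContinuous_spectralCutoff hε
  gap ε _ t := by
    unfold spectralCutoff
    split_ifs with h
    · exact Or.inr h.le
    · exact Or.inl rfl
  tendsto_one t ht := by
    refine tendsto_const_nhds.congr' ?_
    have h : ∀ᶠ ε : ℝ in 𝓝[>] 0, ε < t :=
      nhdsWithin_le_nhds (gt_mem_nhds (NNReal.coe_pos.2 ht))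
    filter_upwards [h] with ε hε
    rw [pinvFun, spectralCutoff, if_pos hε, if_pos ht.ne', mul_one_div, div_self ht.ne']
  bounded := by
    refine ⟨1, fun ε _ t => ?_⟩
    unfold pinvFun spectralCutoff
    split_ifs with h1 h2 h2
    · rw [mul_one_div, div_self h2]
    · simp
    · exact absurd rfl h2
    · simp

end Examples

/-! ### Regularised pseudo-inverses of a positive operator -/

section Regularisation

variable {𝕜 : Type*} [RCLike 𝕜] {E : Type*} [NormedAddCommGroup E] [InnerProductSpace 𝕜 E]
  [CompleteSpace E]

/-- `g(S)` has `g⁺(S)` as its pseudo-inverse when `g` has a gap at `0`. -/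
theorem moorePenrose_regularisedOp {S : E →L[𝕜] E} (hS : IsSelfAdjoint S) {g : ℝ≥0 → ℝ≥0}
    (hg : PiecewiseContinuous g) {ε : ℝ} (hε : 0 < ε) (hgap : ∀ t, g t = 0 ∨ ε ≤ (g t : ℝ)) :
    moorePenrose (regularisedOp g S) (regularisedOp_isSelfAdjoint g S) =
      (regularisedOp (pinvFun g) S : E →ₗ[𝕜] E).toPMap ⊤ := by
  have hf := hg.isLocallyBoundedBorel
  have hf' := isLocallyBoundedBorel_pinvFun hg hε hgap
  have hF : IsCalculusOp S (extendReal g) (regularisedOp g S) :=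
    isCalculusOp_borelCalculus hS hf
  have hQ : IsCalculusOp S (extendReal (pinvFun g)) (regularisedOp (pinvFun g) S) :=
    isCalculusOp_borelCalculus hS hf'
  have hFQ := hF.mul hS hf hf' hQ
  have hQF := hQ.mul hS hf' hf hF
  refine moorePenrose_eq_toPMap _ ?_ ?_ ?_
  · have h := hFQ.mul hS (hf.mul hf') hf hF
    simp only [extendReal_mul_pinvFun_mul] at h
    exact h.unique hS hf hF
  · have h := hQF.mul hS (hf'.mul hf) hf' hQ
    simp only [extendReal_pinvFun_mul_mul] at h
    exact h.unique hS hf' hQ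
  · simp_rw [mul_comm (extendReal (pinvFun g) _)] at hQF
    exact hFQ.unique hS (hf.mul hf') hQF

theorem norm_regularisedOp_pinvFun_le {S : E →L[𝕜] E} (hS : IsSelfAdjoint S) {g : ℝ≥0 → ℝ≥0}
    (hg : PiecewiseContinuous g) {ε : ℝ} (hε : 0 < ε) (hgap : ∀ t, g t = 0 ∨ ε ≤ (g t : ℝ)) :
    ‖regularisedOp (pinvFun g) S‖ ≤ 1 / ε := by
  have hQ : IsCalculusOp S (extendReal (pinvFun g)) (regularisedOp (pinvFun g) S) :=
    isCalculusOp_borelCalculus hS (isLocallyBoundedBorel_pinvFun hg hε hgap)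
  refine ContinuousLinearMap.opNorm_le_bound _ (by positivity) fun a => ?_
  have h := (hQ a).norm_le hS (C := ⟨1 / ε, by positivity⟩)
    fun t _ => extendReal_pinvFun_le hε hgap t
  exact h

/-- For a positive operator `S`, the spectral measure at a vector orthogonal to `ker S` is carried
by `(0, ∞)`: the spectral projection of the vector for `(-∞, 0]` lies in `ker S`. -/
theorem IsSpectralMeasureAt.ae_pos {S : E →L[𝕜] E} (hS : IsSelfAdjoint S)
    (hpos : ∀ b, 0 ≤ RCLike.re (inner 𝕜 b (S b))) {y : E}
    (hy : y ∈ (LinearMap.ker (S : E →ₗ[𝕜] E))ᗮ) {μ : Measure ℝ} (hμ : IsSpectralMeasureAt S y μ) :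
    ∀ᵐ t ∂μ, 0 < t := by
  have := hμ.finite
  let f : ℝ → ℝ := (Set.Iic 0).indicator fun _ => 1
  have hfval : ∀ t, f t = if t ≤ 0 then 1 else 0 := fun t => by
    simp only [f, Set.indicator_apply, Set.mem_Iic]
  have hff : ∀ t, f t * f t = f t := fun t => by rw [hfval]; split_ifs <;> simp
  have hf : IsLocallyBoundedBorel f :=
    ⟨measurable_const.indicator measurableSet_Iic, fun _ => ⟨1, fun t _ => by
      rw [hfval]; split_ifs <;> simp⟩⟩
  have hid : IsLocallyBoundedBorel fun t : ℝ => t := .of_continuous continuous_id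
  -- the spectral projection for `(-∞, 0]`
  obtain ⟨X, hX⟩ := exists_isCalculusOp hS hf
  have hSop : IsCalculusOp S (fun t => t) S := by
    simpa using isCalculusOp_polyOp hS Polynomial.X
  have hSX := hSop.mul hS hid hf hX
  have hXSX := hX.mul hS hf (hid.mul hf) hSX
  have hfun : (fun t => f t * (t * f t)) = fun t => t * f t := by
    ext t; rw [mul_left_comm, hff]
  rw [hfun] at hXSX
  have h1 : inner 𝕜 (X y) (S (X y)) = ((∫ t, t * f t ∂μ : ℝ) : 𝕜) := by
    rw [← (hXSX y).inner_eq (hid.mul hf) hμ]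
    exact hX.isSymmetric hS hf y (S (X y))
  -- positivity of `S` at `X y` forces `t * f t`, which is nonpositive, to vanish almost everywhere
  have h2 : 0 ≤ ∫ t, t * f t ∂μ := by
    have h := hpos (X y)
    rwa [h1, RCLike.ofReal_re] at h
  have hle : ∀ t, 0 ≤ -(t * f t) := fun t => by
    rw [hfval]; split_ifs with h <;> simp [h]
  have h3 : (fun t => -(t * f t)) =ᵐ[μ] 0 := by
    rw [← integral_eq_zero_iff_of_nonneg hle ((hid.mul hf).integrable hμ.ae_abs_le).neg,
      integral_neg]
    have h4 : 0 ≤ ∫ t, -(t * f t) ∂μ := integral_nonneg hle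
    rw [integral_neg] at h4
    linarith
  have h5 : S (X y) = 0 := by
    have h6 := (hSX y).enorm_eq hμ
    have h7 : eLpNorm (fun t => t * f t) 2 μ = 0 := by
      rw [eLpNorm_eq_zero_iff (hid.mul hf).measurable.aestronglyMeasurable (by norm_num)]
      exact h3.mono fun t ht => neg_eq_zero.1 ht
    rw [h7] at h6
    simpa using h6
  have h8 : ((∫ t, f t ∂μ : ℝ) : 𝕜) = 0 := by
    rw [← (hX y).inner_eq hf hμ]
    exact Submodule.inner_left_of_mem_orthogonal (K := LinearMap.ker (S : E →ₗ[𝕜] E)) h5 hy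
  have h9 : ∫ t, f t ∂μ = 0 := by exact_mod_cast h8
  rw [integral_eq_zero_iff_of_nonneg (fun t => by rw [hfval]; split_ifs <;> simp)
    (hf.integrable hμ.ae_abs_le)] at h9
  filter_upwards [h9] with t ht
  by_contra h
  rw [hfval, if_pos (not_lt.1 h)] at ht
  exact one_ne_zero ht

/-- For a spectral regularisation `g` and a positive operator `S`, the operators `g_ε⁺(S) S`
converge strongly to the identity on the orthogonal complement of `ker S`: the squared error is
`∫ (λ g_ε⁺(λ) - 1)² dμ`, to which dominated convergence applies. -/
theorem tendsto_regularisedOp_pinvFun_apply {S : E →L[𝕜] E} (hS : IsSelfAdjoint S)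
    (hpos : ∀ b, 0 ≤ RCLike.re (inner 𝕜 b (S b))) {g : ℝ → ℝ≥0 → ℝ≥0}
    (hg : IsSpectralRegularisation g) {y : E} (hy : y ∈ (LinearMap.ker (S : E →ₗ[𝕜] E))ᗮ) :
    Tendsto (fun ε => ‖regularisedOp (pinvFun (g ε)) S (S y) - y‖) (𝓝[>] 0) (𝓝 0) := by
  obtain ⟨μ, hμ⟩ := exists_isSpectralMeasureAt hS y
  have := hμ.finite
  have hμpos := hμ.ae_pos hS hpos hy
  have hid : IsLocallyBoundedBorel fun t : ℝ => t := .of_continuous continuous_id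
  have hone : IsLocallyBoundedBorel fun _ : ℝ => (1 : ℝ) := .of_continuous continuous_const
  have hSop : IsCalculusOp S (fun t => t) S := by
    simpa using isCalculusOp_polyOp hS Polynomial.X
  have honeop : IsCalculusOp S (fun _ => 1) 1 := by
    simpa using isCalculusOp_polyOp hS 1
  have hlb : ∀ ε > 0, IsLocallyBoundedBorel (extendReal (pinvFun (g ε))) := fun ε hε =>
    isLocallyBoundedBorel_pinvFun (hg.piecewiseContinuous ε hε) hε (hg.gap ε hε)
  have hsq : ∀ ε > 0, ‖regularisedOp (pinvFun (g ε)) S (S y) - y‖ ^ 2 =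
      ∫ t, (extendReal (pinvFun (g ε)) t * t - 1) ^ 2 ∂μ := fun ε hε =>
    (((isCalculusOp_borelCalculus hS (hlb ε hε)).mul hS (hlb ε hε) hid hSop) y).norm_sub_sq
      ((hlb ε hε).mul hid) hone (honeop y) hμ
  have heq : ∀ ε t : ℝ, 0 < t → extendReal (pinvFun (g ε)) t * t =
      ((t.toNNReal * pinvFun (g ε) t.toNNReal : ℝ≥0) : ℝ) := fun ε t ht => by
    rw [NNReal.coe_mul, Real.coe_toNNReal t ht.le, mul_comm, extendReal]
  obtain ⟨C, hC⟩ := hg.bounded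
  have hlim : Tendsto (fun ε => ∫ t, (extendReal (pinvFun (g ε)) t * t - 1) ^ 2 ∂μ) (𝓝[>] 0)
      (𝓝 (∫ _, (0 : ℝ) ∂μ)) := by
    refine tendsto_integral_filter_of_dominated_convergence (fun _ => ((C : ℝ) + 1) ^ 2) ?_ ?_
      (integrable_const _) ?_
    · filter_upwards [self_mem_nhdsWithin] with ε hε
      exact ((((hlb ε hε).mul hid).measurable.sub_const 1).pow_const 2).aestronglyMeasurable
    · filter_upwards [self_mem_nhdsWithin] with ε hε
      filter_upwards [hμpos] with t ht
      have h1 : ((t.toNNReal * pinvFun (g ε) t.toNNReal : ℝ≥0) : ℝ) ≤ C :=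
        NNReal.coe_le_coe.2 (hC ε hε t.toNNReal)
      have h2 := NNReal.coe_nonneg (t.toNNReal * pinvFun (g ε) t.toNNReal)
      rw [heq ε t ht, norm_pow, Real.norm_eq_abs]
      refine pow_le_pow_left₀ (abs_nonneg _) (abs_le.2 ⟨?_, ?_⟩) 2 <;> linarith [C.2]
    · filter_upwards [hμpos] with t ht
      simp_rw [heq _ t ht]
      have h1 := (NNReal.tendsto_coe.2
        (hg.tendsto_one t.toNNReal (Real.toNNReal_pos.2 ht))).sub_const 1
      simpa using h1.pow 2
  rw [integral_zero] at hlim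
  have h := hlim.sqrt
  rw [Real.sqrt_zero] at h
  refine h.congr' ?_
  filter_upwards [self_mem_nhdsWithin] with ε hε
  rw [← hsq ε hε, Real.sqrt_sq (norm_nonneg _)]

end Regularisation

/-! ### The Gram operator of a frame -/

section Gram

variable {𝕜 : Type*} [RCLike 𝕜] {H : Type*} [NormedAddCommGroup H] [InnerProductSpace 𝕜 H]

theorem norm_analysisOp_sq {ι : Type*} (u : ι → H) (hu : IsBessel 𝕜 u) (x : H) :
    ‖analysisOp u hu x‖ ^ 2 = ∑' i, ‖inner 𝕜 (u i) x‖ ^ 2 := by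
  have h2 := lp.norm_rpow_eq_tsum (p := 2) (by norm_num)
    (⟨fun i => inner 𝕜 (u i) x, hu.memlp x⟩ : EllTwo 𝕜 ι)
  simpa using! h2

variable [CompleteSpace H] {E : Type*} [NormedAddCommGroup E] [InnerProductSpace 𝕜 E]
  [CompleteSpace E]

/-- The Gram operator `T T*` of an operator `T` bounded below has the bounded pseudo-inverse
`P = T (T* T)⁻² T*`, and `T T* P` is the orthogonal projection onto the range of `T`. -/
theorem exists_pinv_comp_adjoint (T : H →L[𝕜] E) {A : ℝ} (hA : 0 < A)
    (hT : ∀ x, A * ‖x‖ ^ 2 ≤ ‖T x‖ ^ 2) :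
    ∃ P : E →L[𝕜] E,
      (T ∘L T.adjoint) * P * (T ∘L T.adjoint) = T ∘L T.adjoint ∧
      P * (T ∘L T.adjoint) * P = P ∧
      (T ∘L T.adjoint) * P = P * (T ∘L T.adjoint) ∧
      ∀ x, (T ∘L T.adjoint) (P (T x)) = T x := by
  have hunit : IsUnit (T.adjoint ∘L T) := by
    refine ContinuousLinearMap.isUnit_of_forall_le_norm_inner_map _ (c := ⟨A, hA.le⟩) hA
      fun x => ?_
    have h : inner 𝕜 ((T.adjoint ∘L T) x) x = ((‖T x‖ ^ 2 : ℝ) : 𝕜) := by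
      rw [ContinuousLinearMap.comp_apply, ContinuousLinearMap.adjoint_inner_left,
        inner_self_eq_norm_sq_to_K, RCLike.ofReal_pow]
    rw [h, RCLike.norm_ofReal, abs_of_nonneg (sq_nonneg _), mul_comm]
    exact hT x
  obtain ⟨w, hw⟩ := hunit
  let N : H →L[𝕜] H := (w⁻¹ : (H →L[𝕜] H)ˣ)
  have h1 : ∀ x, T.adjoint (T (N x)) = x := fun x => by
    have h : (T.adjoint ∘L T) * N = 1 := by rw [← hw]; exact w.mul_inv
    exact congrArg (fun L : H →L[𝕜] H => L x) h
  have h2 : ∀ x, N (T.adjoint (T x)) = x := fun x => by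
    have h : N * (T.adjoint ∘L T) = 1 := by rw [← hw]; exact w.inv_mul
    exact congrArg (fun L : H →L[𝕜] H => L x) h
  refine ⟨T ∘L N ∘L N ∘L T.adjoint, ?_, ?_, ?_, fun x => ?_⟩
  · ext z; simp [h1, h2]
  · ext z; simp [h1]
  · ext z; simp [h1, h2]
  · simp [h1, h2]

end Gram

/-! ### Convergence of the regularised pseudo-inverses -/

/-- For the Gram operator `G = T T*` of a frame and a spectral regularisation `g`:
the operator `g ε (G)` is well defined (exists and is unique) for `ε > 0`; the pseudo-inverses of
`G` and of `g ε (G)` are everywhere defined bounded operators `P` and `Q ε`, with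
`‖Q ε‖ ≤ 1 / ε`; and `‖Q ε (T x) - P (T x)‖ → 0` as `ε → 0`. Tikhonov regularisation and spectral
cutoff are spectral regularisations. -/
theorem mainTheorem3 {𝕜 : Type*} [RCLike 𝕜] {ι : Type*} {H : Type*} [NormedAddCommGroup H]
    [InnerProductSpace 𝕜 H] [CompleteSpace H] (u : ι → H) (hu : IsFrame 𝕜 u) :
    (∀ g : ℝ → ℝ≥0 → ℝ≥0, IsSpectralRegularisation g →
      (∀ ε : ℝ, 0 < ε →
        ∃! F : EllTwo 𝕜 ι →L[𝕜] EllTwo 𝕜 ι,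
          IsBorelCalculus (gramOp u hu.isBessel) (extendReal (g ε)) F) ∧
      ∃ (P : EllTwo 𝕜 ι →L[𝕜] EllTwo 𝕜 ι) (Q : ℝ → EllTwo 𝕜 ι →L[𝕜] EllTwo 𝕜 ι),
        moorePenrose (gramOp u hu.isBessel) (gramOp_isSelfAdjoint u hu.isBessel) =
          (P : EllTwo 𝕜 ι →ₗ[𝕜] EllTwo 𝕜 ι).toPMap ⊤ ∧
        (∀ ε : ℝ, 0 < ε →
          moorePenrose (regularisedOp (g ε) (gramOp u hu.isBessel))
              (regularisedOp_isSelfAdjoint (g ε) (gramOp u hu.isBessel)) =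
            (Q ε : EllTwo 𝕜 ι →ₗ[𝕜] EllTwo 𝕜 ι).toPMap ⊤ ∧
          ‖Q ε‖ ≤ 1 / ε) ∧
        ∀ x : H, Tendsto
          (fun ε : ℝ => ‖Q ε (analysisOp u hu.isBessel x) - P (analysisOp u hu.isBessel x)‖)
          (𝓝[>] 0) (𝓝 0)) ∧
    IsSpectralRegularisation tikhonov ∧ IsSpectralRegularisation spectralCutoff := by
  refine ⟨fun g hg => ?_, isSpectralRegularisation_tikhonov,
    isSpectralRegularisation_spectralCutoff⟩
  set T := analysisOp u hu.isBessel with hTdef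
  have hS := gramOp_isSelfAdjoint u hu.isBessel
  have hpos : ∀ b, 0 ≤ RCLike.re (inner 𝕜 b (gramOp u hu.isBessel b)) := fun b => by
    have h : inner 𝕜 b (gramOp u hu.isBessel b) = inner 𝕜 (T.adjoint b) (T.adjoint b) :=
      (T.adjoint_inner_left (T.adjoint b) b).symm
    rw [h]
    exact inner_self_nonneg
  obtain ⟨A, B, hA, -, hAB⟩ := id hu
  obtain ⟨P, hSPS, hPSP, hcomm, hPT⟩ := exists_pinv_comp_adjoint T hA fun x => by
    rw [hTdef, norm_analysisOp_sq]
    exact (hAB x).2.1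
  change gramOp u hu.isBessel * P * gramOp u hu.isBessel = gramOp u hu.isBessel at hSPS
  change P * gramOp u hu.isBessel * P = P at hPSP
  change gramOp u hu.isBessel * P = P * gramOp u hu.isBessel at hcomm
  change ∀ x, gramOp u hu.isBessel (P (T x)) = T x at hPT
  -- the definition of `Q ε` for `ε ≤ 0` is immaterial
  refine ⟨fun ε hε => ?_, P, fun ε => regularisedOp (pinvFun (g ε)) (gramOp u hu.isBessel),
    moorePenrose_eq_toPMap hS hSPS hPSP hcomm, fun ε hε => ⟨?_, ?_⟩, fun x => ?_⟩
  · have hf := (hg.piecewiseContinuous ε hε).isLocallyBoundedBorel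
    obtain ⟨F, hF⟩ := exists_isCalculusOp hS hf
    exact ⟨F, hF.isBorelCalculus hS hf, fun K hK => hK.unique (hF.isBorelCalculus hS hf)⟩
  · exact moorePenrose_regularisedOp hS (hg.piecewiseContinuous ε hε) hε (hg.gap ε hε)
  · exact norm_regularisedOp_pinvFun_le hS (hg.piecewiseContinuous ε hε) hε (hg.gap ε hε)
  · -- `T x = G y` with `y = P (T x)` in the range of `G`, hence orthogonal to its kernel
    have hy : P (T x) ∈
        (LinearMap.ker (gramOp u hu.isBessel : EllTwo 𝕜 ι →ₗ[𝕜] EllTwo 𝕜 ι))ᗮ := by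
      have h : P (T x) = gramOp u hu.isBessel (P (P (T x))) := by
        have h1 := congrArg (fun L : EllTwo 𝕜 ι →L[𝕜] EllTwo 𝕜 ι => L (T x)) hPSP
        have h2 := congrArg (fun L : EllTwo 𝕜 ι →L[𝕜] EllTwo 𝕜 ι => L (P (T x))) hcomm
        exact h1.symm.trans h2.symm
      rw [h]
      exact apply_mem_ker_orthogonal (ContinuousLinearMap.isSelfAdjoint_iff_isSymmetric.1 hS) _
    have h := tendsto_regularisedOp_pinvFun_apply hS hpos hg hy
    simp_rw [hPT] at h
    exact h
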